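/- **Setting.** $\|\cdot\|$ is the Euclidean norm of vectors and the spectral norm of matrices, and $n:=\max(N,T)$. Let $X=LF^\top+E$ with $L\in\mathbb R^{N\times r}$ deterministic, $F=[f_1,\dots,f_T]^\top\in\mathbb R^{T\times r}$ and $E\in\mathbb R^{N\times T}$ random, $r\ge 1$, and assume: * (Factors.) $F$ is independent of $E$; $\sup_{t\le T}\|f_t\|_{\psi_2}<\infty$; $\mathbb E f_tf_t^\top=I_r$ for all $t\le T$; and $\mathbb P\big(\|\frac1T\sum_{t=1}^T f_tf_t^\top-I_r\|\ge\delta_F\big)\le\eta_F$ with $\delta_F\le 1/2$. * (Loadings.) $L^\top L=\mathrm{diag}(\lambda_1^2,\dots,\lambda_r^2)$ with $\lambda_1\ge\dots\ge\lambda_r>0$. * (Separable Gaussian noise.) $\mathrm{vec}(E)\sim\mathcal N(0,\Sigma_C\otimes\Sigma_T)$ with $\Sigma_C\in\mathbb R^{N\times N}$, $\Sigma_T\in\mathbb R^{T\times T}$ symmetric positive definite, i.e. $E$ is a centred Gaussian matrix with $\mathrm{Cov}(E_{it},E_{js})=(\Sigma_C)_{ij}(\Sigma_T)_{ts}$. Let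 $Q\in\mathbb R^{T\times T}$ be a deterministic symmetric weight matrix with $\mathrm{rank}(Q)\ge r$. Let $(U,\Sigma,V)$ be the rank-$r$ SVD of $T^{-1/2}LF^\top$, let $\tilde U_Q\in\mathbb R^{N\times r}$ be the leading $r$ left singular vectors of $XQX^\top$, and let $(\hat U_Q,\hat\Sigma_Q,\hat V_Q)$ be the rank-$r$ truncated SVD of $T^{-1/2}\tilde U_Q\tilde U_Q^\top X$. Put $$\mathrm{Err}_V(Q):=\Big(\sqrt T+\sqrt n\,\|\hat U_Q\hat U_Q^\top-UU^\top\|\Big)\|\Sigma_T^{1/2}\|\,\|\Sigma_C^{1/2}\|+\lambda_1\sqrt T\,\|\hat U_Q\hat U_Q^\top-UU^\top\|.$$ **Theorem.** For all $A,c>0$ there are constants $c_0,C_0,C_1,C_2>0$, depending only on $A$ and $c$, such that for all $N,T,r$ and all models as above with $$T\le A\,e^{cN}\quad\text{and}\quad \log n\le A\,T,$$ there is an event of probability at least $1-\eta_F-C_2\big(e^{-c_0N}+n^{-9}\big)$ on which, for every choice of the above singular vectors, if $\lambda_r\sqrt T\ge C_0\,\mathrm{Err}_V(Q)$, then $$\|\hat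 V_Q\hat V_Q^\top-VV^\top\|\le C_1\,\frac{\mathrm{Err}_V(Q)}{\lambda_r\sqrt T}.$$ -/

import Mathlib

open MeasureTheory ProbabilityTheory
open scoped Matrix Kronecker ENNReal NNReal Matrix.Norms.L2Operator MatrixOrder

/-! Matrix norms below are spectral norms (the scope `Matrix.Norms.L2Operator` is open), and
`CFC.sqrt S` is the positive semidefinite square root of a positive semidefinite matrix `S`. -/

noncomputable section

namespace WPCA

/-- The Orlicz `ψ₂`-norm of a real random variable,
`inf {K > 0 : 𝔼 exp (Z² / K²) ≤ 2}` (equal to `∞` when there is no such `K`). -/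
def psi2Norm {Ω : Type*} [MeasurableSpace Ω] (μ : Measure Ω) (Z : Ω → ℝ) : ℝ≥0∞ :=
  ⨅ (K : ℝ≥0) (_ : 0 < K)
    (_ : ∫⁻ ω, ENNReal.ofReal (Real.exp ((Z ω / (K : ℝ)) ^ 2)) ∂μ ≤ 2), (K : ℝ≥0∞)

/-- The `ψ₂`-norm of a random vector: the supremum of the `ψ₂`-norms of its one-dimensional
marginals in unit directions. -/
def vecPsi2Norm {Ω : Type*} [MeasurableSpace Ω] (μ : Measure Ω) {r : ℕ}
    (f : Ω → Fin r → ℝ) : ℝ≥0∞ :=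
  ⨆ (x : Fin r → ℝ) (_ : x ⬝ᵥ x = 1), psi2Norm μ (fun ω => x ⬝ᵥ f ω)

/-- The factor model assumption.  The `t`-th factor `f_t` is the row `F ω t`; note that
`T⁻¹ ∑ₜ f_t f_tᵀ = T⁻¹ Fᵀ F` and that its expectation is the identity. -/
structure FactorAssumption {Ω : Type*} [MeasurableSpace Ω] (μ : Measure Ω) {N T r : ℕ}
    (L : Matrix (Fin N) (Fin r) ℝ) (lam : Fin r → ℝ)
    (F : Ω → Matrix (Fin T) (Fin r) ℝ) (E : Ω → Matrix (Fin N) (Fin T) ℝ)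
    (δ η : ℝ) : Prop where
  measurable_factor : ∀ t j, Measurable fun ω => F ω t j
  measurable_noise : ∀ i t, Measurable fun ω => E ω i t
  indep : IndepFun (fun ω (p : Fin T × Fin r) => F ω p.1 p.2)
    (fun ω (p : Fin N × Fin T) => E ω p.1 p.2) μ
  subgaussian : ⨆ t, vecPsi2Norm μ (fun ω => F ω t) < ∞
  second_moment : ∀ t j k, ∫ ω, F ω t j * F ω t k ∂μ = if j = k then 1 else 0
  concentration : μ.real {ω | δ ≤ ‖(T : ℝ)⁻¹ • ((F ω)ᵀ * F ω) - 1‖} ≤ η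
  loading : Lᵀ * L = Matrix.diagonal fun j => lam j ^ 2
  lam_antitone : Antitone lam
  lam_pos : ∀ j, 0 < lam j

/-- Separable Gaussian noise: `vec E ∼ N(0, S_C ⊗ S_T)`, i.e. `E` is a centred Gaussian matrix with
`Cov (E i t, E j s) = S_C i j * S_T t s`. -/
def SeparableGaussian {Ω : Type*} [MeasurableSpace Ω] (μ : Measure Ω) {N T : ℕ}
    (E : Ω → Matrix (Fin N) (Fin T) ℝ)
    (S_C : Matrix (Fin N) (Fin N) ℝ) (S_T : Matrix (Fin T) (Fin T) ℝ) : Prop :=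
  HasLaw (fun ω => WithLp.toLp 2 fun p : Fin N × Fin T => E ω p.1 p.2)
    (multivariateGaussian 0 (S_C ⊗ₖ S_T)) μ

/-- `(U, diag s, V)` is a rank-`r` truncated singular value decomposition of `A`: orthonormal
left and right singular vectors for `s₁ ≥ ⋯ ≥ s_r ≥ 0`, where no singular value of the remainder
exceeds `s_r`, so that the `s_i` are the `r` largest singular values. -/
structure IsTruncSVD {m n r : ℕ} (A : Matrix (Fin m) (Fin n) ℝ)
    (U : Matrix (Fin m) (Fin r) ℝ) (s : Fin r → ℝ) (V : Matrix (Fin n) (Fin r) ℝ) : Prop where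
  left_orthonormal : Uᵀ * U = 1
  right_orthonormal : Vᵀ * V = 1
  nonneg : ∀ i, 0 ≤ s i
  antitone : Antitone s
  mul_right : A * V = U * Matrix.diagonal s
  mul_left : Aᵀ * U = V * Matrix.diagonal s
  remainder_le : ∀ i, ‖A - U * Matrix.diagonal s * Vᵀ‖ ≤ s i

/-- The data matrix `X = L Fᵀ + E`. -/
def dataMatrix {N T r : ℕ} (L : Matrix (Fin N) (Fin r) ℝ) (F : Matrix (Fin T) (Fin r) ℝ)
    (E : Matrix (Fin N) (Fin T) ℝ) : Matrix (Fin N) (Fin T) ℝ :=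
  L * Fᵀ + E

/-- `(Uhat, diag s, Vhat)` is an output of weighted PCA on `X` with weight matrix `Q`: with
`Utilde` the leading `r` left singular vectors of `X Q Xᵀ`, it is a rank-`r` singular value
decomposition of `T^{-1/2} Utilde Utildeᵀ X`. -/
def IsWeightedPCA {N T r : ℕ} (X : Matrix (Fin N) (Fin T) ℝ) (Q : Matrix (Fin T) (Fin T) ℝ)
    (Uhat : Matrix (Fin N) (Fin r) ℝ) (s : Fin r → ℝ) (Vhat : Matrix (Fin T) (Fin r) ℝ) : Prop :=
  ∃ (Utilde : Matrix (Fin N) (Fin r) ℝ) (d : Fin r → ℝ) (W : Matrix (Fin N) (Fin r) ℝ),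
    IsTruncSVD (X * Q * Xᵀ) Utilde d W ∧
      IsTruncSVD ((√(T : ℝ))⁻¹ • (Utilde * Utildeᵀ * X)) Uhat s Vhat

/-- `Err_V`, where `lam₁` is the largest factor strength and `ξ` is the spectral-norm error of the
left subspace. -/
def errV {N T : ℕ} (lam₁ : ℝ) (S_C : Matrix (Fin N) (Fin N) ℝ) (S_T : Matrix (Fin T) (Fin T) ℝ)
    (ξ : ℝ) : ℝ :=
  (√(T : ℝ) + √(max N T : ℝ) * ξ) * ‖CFC.sqrt S_T‖ * ‖CFC.sqrt S_C‖ + lam₁ * √(T : ℝ) * ξ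

end WPCA

end

/-!
Write `κ = ‖S_T^{1/2}‖ ‖S_C^{1/2}‖`. A union bound over nets of the unit balls gives `‖E‖ ≲ √n κ`,
and also `‖Yᵀ E‖ ≲ √T κ` for the fixed orthonormal basis `Y` of the column space of `L`, since
`Yᵀ E` has only `r ≤ T` rows. Almost surely `X` has full rank, because conditionally on `F` it has
a density; then the column space of `Utilde` lies in that of `X`, so `T^{-1/2} Utilde Utildeᵀ X` has
rank `r` and `Uhat`, `Utilde` span the same space. Splitting
`Uhat Uhatᵀ X - L Fᵀ = (Uhat Uhatᵀ - U Uᵀ) X + U Uᵀ E` now shows that `T^{-1/2} Uhat Uhatᵀ X` is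
within a constant times `Err_V / √T` of `T^{-1/2} L Fᵀ`, whose nonzero singular values are at least
`λ_r / 2`, and Wedin's theorem compares the right singular subspaces of these two matrices.
-/

namespace WPCA

open Matrix

section SpectralNorm

variable {k m n : Type*} [Fintype k] [Fintype m] [Fintype n]

lemma l2_opNorm_transpose [DecidableEq m] [DecidableEq n] (A : Matrix m n ℝ) : ‖Aᵀ‖ = ‖A‖ := by
  rw [← conjTranspose_eq_transpose_of_trivial, l2_opNorm_conjTranspose]

lemma l2_opNorm_transpose_mul_self [DecidableEq n] (A : Matrix m n ℝ) : ‖Aᵀ * A‖ = ‖A‖ * ‖A‖ := by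
  rw [← conjTranspose_eq_transpose_of_trivial, l2_opNorm_conjTranspose_mul_self]

lemma l2_opNorm_one_le [DecidableEq n] : ‖(1 : Matrix n n ℝ)‖ ≤ 1 :=
  IsStarProjection.norm_le 1 (.one _)

lemma l2_opNorm_le_one_of_orthonormal [DecidableEq n] {U : Matrix m n ℝ}
    (hU : Uᵀ * U = 1) : ‖U‖ ≤ 1 := by
  have hsq : ‖U‖ * ‖U‖ ≤ 1 := by
    rw [← l2_opNorm_transpose_mul_self, hU]
    exact l2_opNorm_one_le
  nlinarith [norm_nonneg U]

lemma l2_opNorm_orthonormal_mul [DecidableEq k] [DecidableEq n] {U : Matrix m n ℝ}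
    (hU : Uᵀ * U = 1) (A : Matrix n k ℝ) : ‖U * A‖ = ‖A‖ := by
  have hgram : (U * A)ᵀ * (U * A) = Aᵀ * A := by
    rw [transpose_mul, Matrix.mul_assoc, ← Matrix.mul_assoc Uᵀ, hU, Matrix.one_mul]
  have hsq := congrArg norm hgram
  rw [l2_opNorm_transpose_mul_self, l2_opNorm_transpose_mul_self] at hsq
  exact (mul_self_inj (norm_nonneg _) (norm_nonneg _)).1 hsq

lemma isStarProjection_mul_transpose [DecidableEq n] {U : Matrix m n ℝ} (hU : Uᵀ * U = 1) :
    IsStarProjection (U * Uᵀ) where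
  isIdempotentElem := by
    rw [IsIdempotentElem, Matrix.mul_assoc, ← Matrix.mul_assoc Uᵀ, hU, Matrix.one_mul]
  isSelfAdjoint := by
    rw [IsSelfAdjoint, star_eq_conjTranspose, conjTranspose_eq_transpose_of_trivial,
      transpose_mul, transpose_transpose]

lemma l2_opNorm_one_sub_proj_le [DecidableEq m] [DecidableEq n] {U : Matrix m n ℝ}
    (hU : Uᵀ * U = 1) : ‖1 - U * Uᵀ‖ ≤ 1 :=
  IsStarProjection.norm_le _ (isStarProjection_mul_transpose hU).one_sub

lemma proj_eq_of_eq_mul [DecidableEq n] {U Y : Matrix m n ℝ} {Z : Matrix n n ℝ} (hU : Uᵀ * U = 1)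
    (hY : Yᵀ * Y = 1) (h : U = Y * Z) : U * Uᵀ = Y * Yᵀ := by
  have hZ : Zᵀ * Z = 1 := by
    rw [← hU, h, transpose_mul, Matrix.mul_assoc, ← Matrix.mul_assoc Yᵀ, hY, Matrix.one_mul]
  rw [h, transpose_mul, Matrix.mul_assoc, ← Matrix.mul_assoc Z, mul_eq_one_comm.1 hZ,
    Matrix.one_mul]

lemma norm_proj_sub_proj_le [DecidableEq m] (V V' : Matrix m n ℝ) :
    ‖V' * V'ᵀ - V * Vᵀ‖ ≤ ‖(1 - V' * V'ᵀ) * (V * Vᵀ)‖ + ‖(1 - V * Vᵀ) * (V' * V'ᵀ)‖ := by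
  have hsplit : V' * V'ᵀ - V * Vᵀ
      = ((1 - V * Vᵀ) * (V' * V'ᵀ))ᵀ - (1 - V' * V'ᵀ) * (V * Vᵀ) := by
    simp only [transpose_mul, transpose_sub, transpose_transpose, Matrix.sub_mul,
      Matrix.one_mul]
    abel
  rw [hsplit, add_comm, ← l2_opNorm_transpose ((1 - V * Vᵀ) * _)]
  exact norm_sub_le _ _

lemma l2_opNorm_diagonal_le [DecidableEq n] {s : n → ℝ} {b : ℝ} (hb : 0 ≤ b) (hs0 : ∀ i, 0 ≤ s i)
    (hs : ∀ i, s i ≤ b) : ‖diagonal s‖ ≤ b := by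
  rw [l2_opNorm_diagonal, pi_norm_le_iff_of_nonneg hb]
  exact fun i => (Real.norm_of_nonneg (hs0 i)).trans_le (hs i)

lemma diagonal_mul_diagonal_inv [DecidableEq n] {s : n → ℝ} (hs : ∀ i, 0 < s i) :
    diagonal s * diagonal s⁻¹ = 1 := by
  simp [diagonal_mul_diagonal, (hs _).ne']

lemma l2_opNorm_diagonal_inv_le [DecidableEq n] {s : n → ℝ} {σ : ℝ} (hσ : 0 < σ)
    (hs : ∀ i, σ ≤ s i) : ‖diagonal s⁻¹‖ ≤ σ⁻¹ :=
  l2_opNorm_diagonal_le (inv_nonneg.2 hσ.le) (fun i => inv_nonneg.2 (hσ.le.trans (hs i)))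
    fun i => inv_anti₀ hσ (hs i)

end SpectralNorm

lemma exists_unit_eq_norm_inv_le {R : Type*} [NormedRing R] [HasSummableGeomSeries R] (u : Rˣ)
    {x : R} {σ ε : ℝ} (hε0 : 0 ≤ ε) (hε : ε < σ) (hu : ‖(↑u⁻¹ : R)‖ ≤ σ⁻¹)
    (hx : ‖x - u‖ ≤ ε) : ∃ v : Rˣ, ↑v = x ∧ ‖(↑v⁻¹ : R)‖ ≤ (σ - ε)⁻¹ := by
  have hσ : 0 < σ := hε0.trans_lt hε
  have hsmall : ‖(↑u⁻¹ : R) * (u - x)‖ ≤ σ⁻¹ * ε := by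
    refine (norm_mul_le _ _).trans ?_
    rw [norm_sub_rev (u : R)]
    gcongr
  have hlt : σ⁻¹ * ε < 1 := by rwa [inv_mul_lt_one₀ hσ]
  obtain ⟨v, hv⟩ : IsUnit x := by
    have hfac : x = u * (1 - ↑u⁻¹ * (u - x)) := by simp [mul_sub]
    rw [hfac]
    exact u.isUnit.mul (isUnit_one_sub_of_norm_lt_one (hsmall.trans_lt hlt))
  refine ⟨v, hv, ?_⟩
  have hres : (↑v⁻¹ : R) = ↑u⁻¹ + ↑u⁻¹ * (u - x) * ↑v⁻¹ := by
    rw [← hv]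
    simp [mul_sub, sub_mul, mul_assoc]
  have hbound : ‖(↑v⁻¹ : R)‖ ≤ σ⁻¹ + σ⁻¹ * ε * ‖(↑v⁻¹ : R)‖ := by
    conv_lhs => rw [hres]
    refine (norm_add_le _ _).trans (add_le_add hu ((norm_mul_le _ _).trans ?_))
    gcongr
  rw [inv_eq_one_div (σ - ε), le_div_iff₀ (sub_pos.2 hε)]
  calc ‖(↑v⁻¹ : R)‖ * (σ - ε) = σ * (‖(↑v⁻¹ : R)‖ - σ⁻¹ * ε * ‖(↑v⁻¹ : R)‖) := by field_simp
    _ ≤ σ * σ⁻¹ := by gcongr; linarith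
    _ = 1 := mul_inv_cancel₀ hσ.ne'

namespace IsTruncSVD

variable {m n r : ℕ} {A A' : Matrix (Fin m) (Fin n) ℝ} {U U' : Matrix (Fin m) (Fin r) ℝ}
  {s s' : Fin r → ℝ} {V V' : Matrix (Fin n) (Fin r) ℝ}

lemma transpose_left_mul (h : IsTruncSVD A U s V) : Uᵀ * A = diagonal s * Vᵀ := by
  rw [← transpose_inj, transpose_mul, transpose_transpose, h.mul_left, transpose_mul,
    transpose_transpose, diagonal_transpose]

lemma eq_of_eq_zero (h : IsTruncSVD A U s V) {i : Fin r} (hi : s i = 0) :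
    A = U * diagonal s * Vᵀ :=
  sub_eq_zero.1 (norm_le_zero_iff.1 ((h.remainder_le i).trans_eq hi))

lemma pos_of_le_rank (h : IsTruncSVD A U s V) (hA : r ≤ A.rank) (i : Fin r) : 0 < s i := by
  refine (h.nonneg i).lt_of_ne' fun hi => ?_
  have hrank : A.rank ≤ (diagonal s).rank := by
    rw [h.eq_of_eq_zero hi]
    exact (rank_mul_le_left _ _).trans (rank_mul_le_right _ _)
  have hcard : Fintype.card {j // s j ≠ 0} < Fintype.card (Fin r) :=
    Fintype.card_subtype_lt (x := i) (not_not.2 hi)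
  rw [rank_diagonal] at hrank
  rw [Fintype.card_fin] at hcard
  omega

lemma pos_of_mul_mul_eq_one (h : IsTruncSVD A U s V) {B : Matrix (Fin r) (Fin m) ℝ}
    {W : Matrix (Fin n) (Fin r) ℝ} (hBW : B * A * W = 1) (i : Fin r) : 0 < s i := by
  refine h.pos_of_le_rank ?_ i
  calc r = (B * A * W).rank := by rw [hBW, rank_one, Fintype.card_fin]
    _ ≤ A.rank := (rank_mul_le_left _ _).trans (rank_mul_le_right _ _)

lemma eq_mul (h : IsTruncSVD A U s V) (hs : ∀ i, 0 < s i) :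
    U = A * (V * diagonal s⁻¹) := by
  rw [← Matrix.mul_assoc, h.mul_right, Matrix.mul_assoc, diagonal_mul_diagonal_inv hs,
    Matrix.mul_one]

lemma proj_eq (h : IsTruncSVD A U s V) (hs : ∀ i, 0 < s i) {Y : Matrix (Fin m) (Fin r) ℝ}
    {Z : Matrix (Fin r) (Fin n) ℝ} (hY : Yᵀ * Y = 1) (hA : A = Y * Z) : U * Uᵀ = Y * Yᵀ := by
  have hU := h.eq_mul hs
  rw [hA, Matrix.mul_assoc] at hU
  exact proj_eq_of_eq_mul h.left_orthonormal hY hU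

lemma eq_of_eq_mul (h : IsTruncSVD A U s V) (hs : ∀ i, 0 < s i) {Y : Matrix (Fin m) (Fin r) ℝ}
    {Z : Matrix (Fin r) (Fin n) ℝ} (hY : Yᵀ * Y = 1) (hA : A = Y * Z) :
    A = U * diagonal s * Vᵀ := by
  calc A = Y * Yᵀ * A := by rw [hA, Matrix.mul_assoc, ← Matrix.mul_assoc Yᵀ, hY, Matrix.one_mul]
    _ = U * diagonal s * Vᵀ := by
      rw [← h.proj_eq hs hY hA, Matrix.mul_assoc, h.transpose_left_mul, Matrix.mul_assoc]

lemma inv_le_of_mul_mul_eq_one (h : IsTruncSVD A U s V) (hA : A = U * diagonal s * Vᵀ)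
    {B : Matrix (Fin r) (Fin m) ℝ} {W : Matrix (Fin n) (Fin r) ℝ} (hBW : B * A * W = 1)
    (i : Fin r) : (s i)⁻¹ ≤ ‖W‖ * ‖B‖ := by
  have hs := h.pos_of_mul_mul_eq_one hBW
  have hinv : diagonal s⁻¹ = Vᵀ * W * (B * U) := by
    have hone : B * U * (diagonal s * (Vᵀ * W)) = 1 := by
      rw [← hBW, hA]
      simp only [Matrix.mul_assoc]
    have hcomm := mul_eq_one_comm.1 hone
    rw [Matrix.mul_assoc] at hcomm
    exact left_inv_eq_right_inv (mul_eq_one_comm.1 (diagonal_mul_diagonal_inv hs)) hcomm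
  have hV : ‖Vᵀ‖ ≤ 1 := by
    rw [l2_opNorm_transpose]
    exact l2_opNorm_le_one_of_orthonormal h.right_orthonormal
  calc (s i)⁻¹ ≤ ‖diagonal s⁻¹‖ := by
        rw [l2_opNorm_diagonal]
        exact (le_abs_self _).trans (norm_le_pi_norm s⁻¹ i)
    _ ≤ ‖Vᵀ‖ * ‖W‖ * (‖B‖ * ‖U‖) := by
        rw [hinv]
        refine (l2_opNorm_mul _ _).trans ?_
        gcongr <;> exact l2_opNorm_mul _ _
    _ ≤ 1 * ‖W‖ * (‖B‖ * 1) := by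
        gcongr
        exact l2_opNorm_le_one_of_orthonormal h.left_orthonormal
    _ = ‖W‖ * ‖B‖ := by ring

lemma sub_le_of_norm_sub_le (h : IsTruncSVD A U s V) (h' : IsTruncSVD A' U' s' V')
    (hA' : A' = U' * diagonal s' * V'ᵀ) {σ ε : ℝ} (hε : ε < σ) (hs : ∀ i, σ ≤ s i)
    (hAA' : ‖A' - A‖ ≤ ε) (i : Fin r) : σ - ε ≤ s' i := by
  have hε0 : 0 ≤ ε := (norm_nonneg _).trans hAA'
  have hσ : 0 < σ := hε0.trans_lt hε
  have hU := l2_opNorm_le_one_of_orthonormal h.left_orthonormal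
  have hV := l2_opNorm_le_one_of_orthonormal h.right_orthonormal
  have hinv := diagonal_mul_diagonal_inv fun i => hσ.trans_le (hs i)
  have hcompr : ‖Uᵀ * A' * V - diagonal s‖ ≤ ε := by
    have heq : Uᵀ * A' * V - diagonal s = Uᵀ * (A' - A) * V := by
      rw [Matrix.mul_sub, Matrix.sub_mul, h.transpose_left_mul, Matrix.mul_assoc (diagonal s),
        h.right_orthonormal, Matrix.mul_one]
    calc ‖Uᵀ * A' * V - diagonal s‖ ≤ ‖Uᵀ‖ * ‖A' - A‖ * ‖V‖ := by
          rw [heq]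
          exact (l2_opNorm_mul _ _).trans (by gcongr; exact l2_opNorm_mul _ _)
      _ ≤ 1 * ε * 1 := by
          rw [l2_opNorm_transpose]
          gcongr
      _ = ε := by ring
  obtain ⟨G, hG, hGinv⟩ := exists_unit_eq_norm_inv_le
    ⟨diagonal s, diagonal s⁻¹, hinv, mul_eq_one_comm.1 hinv⟩ hε0 hε
    (l2_opNorm_diagonal_inv_le hσ hs) hcompr
  have hone : Uᵀ * A' * (V * (↑G⁻¹ : Matrix (Fin r) (Fin r) ℝ)) = 1 := by
    rw [← Matrix.mul_assoc, ← hG, Units.mul_inv]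
  rw [← inv_le_inv₀ (h'.pos_of_mul_mul_eq_one hone i) (sub_pos.2 hε)]
  calc (s' i)⁻¹ ≤ ‖V * (↑G⁻¹ : Matrix (Fin r) (Fin r) ℝ)‖ * ‖Uᵀ‖ :=
        h'.inv_le_of_mul_mul_eq_one hA' hone i
    _ ≤ (σ - ε)⁻¹ * 1 := by
        rw [l2_opNorm_orthonormal_mul h.right_orthonormal, l2_opNorm_transpose]
        gcongr
    _ = (σ - ε)⁻¹ := mul_one _

lemma norm_one_sub_proj_mul_le (h : IsTruncSVD A U s V) {σ : ℝ} (hσ : 0 < σ)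
    (hs : ∀ i, σ ≤ s i) (hV' : V'ᵀ * V' = 1) {Z : Matrix (Fin m) (Fin r) ℝ}
    (hA' : A' = Z * V'ᵀ) : ‖(1 - V' * V'ᵀ) * (V * Vᵀ)‖ ≤ ‖A - A'‖ / σ := by
  have hkill : (1 - V' * V'ᵀ) * (A - A')ᵀ = (1 - V' * V'ᵀ) * Aᵀ := by
    have hzero : (1 - V' * V'ᵀ) * A'ᵀ = 0 := by
      rw [hA', transpose_mul, transpose_transpose, ← Matrix.mul_assoc, Matrix.sub_mul,
        Matrix.one_mul, Matrix.mul_assoc V', hV', Matrix.mul_one, sub_self, Matrix.zero_mul]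
    rw [transpose_sub, Matrix.mul_sub, hzero, sub_zero]
  have hV : V = Aᵀ * U * diagonal s⁻¹ := by
    rw [h.mul_left, Matrix.mul_assoc, diagonal_mul_diagonal_inv fun i => hσ.trans_le (hs i),
      Matrix.mul_one]
  have hrepr : (1 - V' * V'ᵀ) * (V * Vᵀ)
      = (1 - V' * V'ᵀ) * (A - A')ᵀ * (U * (diagonal s⁻¹ * Vᵀ)) := by
    rw [hkill]
    nth_rw 1 [hV]
    simp only [Matrix.mul_assoc]
  have hP : ‖(1 - V' * V'ᵀ) * (A - A')ᵀ‖ ≤ ‖A - A'‖ := by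
    refine (l2_opNorm_mul _ _).trans ?_
    rw [l2_opNorm_transpose]
    exact mul_le_of_le_one_left (norm_nonneg _) (l2_opNorm_one_sub_proj_le hV')
  have hW : ‖U * (diagonal s⁻¹ * Vᵀ)‖ ≤ σ⁻¹ := by
    rw [l2_opNorm_orthonormal_mul h.left_orthonormal, ← l2_opNorm_transpose, transpose_mul,
      transpose_transpose, l2_opNorm_orthonormal_mul h.right_orthonormal, l2_opNorm_transpose]
    exact l2_opNorm_diagonal_inv_le hσ hs
  calc ‖(1 - V' * V'ᵀ) * (V * Vᵀ)‖
      ≤ ‖(1 - V' * V'ᵀ) * (A - A')ᵀ‖ * ‖U * (diagonal s⁻¹ * Vᵀ)‖ := by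
        rw [hrepr]
        exact l2_opNorm_mul _ _
    _ ≤ ‖A - A'‖ * σ⁻¹ := by gcongr
    _ = ‖A - A'‖ / σ := (div_eq_mul_inv _ _).symm

lemma norm_right_proj_sub_le (h : IsTruncSVD A U s V) (hA : A = U * diagonal s * Vᵀ)
    (h' : IsTruncSVD A' U' s' V') (hA' : A' = U' * diagonal s' * V'ᵀ) {σ : ℝ} (hσ : 0 < σ)
    (hs : ∀ i, σ ≤ s i) (hAA' : ‖A' - A‖ ≤ σ / 2) :
    ‖V' * V'ᵀ - V * Vᵀ‖ ≤ 3 * ‖A' - A‖ / σ := by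
  have hs' : ∀ i, σ / 2 ≤ s' i := fun i => by
    have := h.sub_le_of_norm_sub_le h' hA' (half_lt_self hσ) hs hAA' i
    linarith
  calc ‖V' * V'ᵀ - V * Vᵀ‖
      ≤ ‖(1 - V' * V'ᵀ) * (V * Vᵀ)‖ + ‖(1 - V * Vᵀ) * (V' * V'ᵀ)‖ := norm_proj_sub_proj_le V V'
    _ ≤ ‖A - A'‖ / σ + ‖A' - A‖ / (σ / 2) := add_le_add
        (h.norm_one_sub_proj_mul_le hσ hs h'.right_orthonormal hA')
        (h'.norm_one_sub_proj_mul_le (half_pos hσ) hs' h.right_orthonormal hA)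
    _ = 3 * ‖A' - A‖ / σ := by
        rw [norm_sub_rev]
        field_simp
        norm_num

end IsTruncSVD

section WeightedPCA

/-- `X` has full rank, in the form used to solve for `Utilde` in `X Q Xᵀ`: it has a right inverse
or a left inverse. -/
def HasOneSidedInverse {m n : Type*} [Fintype m] [Fintype n] [DecidableEq m] [DecidableEq n]
    (X : Matrix m n ℝ) : Prop :=
  (∃ W : Matrix n m ℝ, X * W = 1) ∨ ∃ W : Matrix n m ℝ, W * X = 1

variable {N T r : ℕ} {X : Matrix (Fin N) (Fin T) ℝ} {Q : Matrix (Fin T) (Fin T) ℝ}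

lemma exists_eq_mul_of_isTruncSVD_weighted {Ut W : Matrix (Fin N) (Fin r) ℝ} {d : Fin r → ℝ}
    (h : IsTruncSVD (X * Q * Xᵀ) Ut d W) (hQ : r ≤ Q.rank)
    (hX : HasOneSidedInverse X) : ∃ Z : Matrix (Fin T) (Fin r) ℝ, Ut = X * Z := by
  rcases hX with ⟨R, hR⟩ | ⟨R, hR⟩
  · exact ⟨R * Ut, by rw [← Matrix.mul_assoc, hR, Matrix.one_mul]⟩
  · have hrank : Q.rank ≤ (X * Q * Xᵀ).rank := by
      have hsandwich : Q = R * (X * Q * Xᵀ) * Rᵀ := by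
        calc Q = (R * X) * Q * (R * X)ᵀ := by
              rw [hR, transpose_one, Matrix.one_mul, Matrix.mul_one]
          _ = R * (X * Q * Xᵀ) * Rᵀ := by simp only [transpose_mul, Matrix.mul_assoc]
      nth_rw 1 [hsandwich]
      exact (rank_mul_le_left _ _).trans (rank_mul_le_right _ _)
    refine ⟨Q * Xᵀ * (W * diagonal d⁻¹), ?_⟩
    rw [← Matrix.mul_assoc X, ← Matrix.mul_assoc X]
    exact h.eq_mul (h.pos_of_le_rank (hQ.trans hrank))

lemma IsWeightedPCA.isTruncSVD_and_eq {Uhat : Matrix (Fin N) (Fin r) ℝ} {s : Fin r → ℝ}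
    {Vhat : Matrix (Fin T) (Fin r) ℝ} (h : IsWeightedPCA X Q Uhat s Vhat) (hT : 0 < T)
    (hQ : r ≤ Q.rank) (hX : HasOneSidedInverse X) :
    IsTruncSVD ((√(T : ℝ))⁻¹ • (Uhat * Uhatᵀ * X)) Uhat s Vhat ∧
      (√(T : ℝ))⁻¹ • (Uhat * Uhatᵀ * X) = Uhat * diagonal s * Vhatᵀ := by
  obtain ⟨Ut, d, W, hUt, hsvd⟩ := h
  obtain ⟨Z, hZ⟩ := exists_eq_mul_of_isTruncSVD_weighted hUt hQ hX
  have hw : √(T : ℝ) ≠ 0 := by positivity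
  have hinv : Utᵀ * ((√(T : ℝ))⁻¹ • (Ut * Utᵀ * X)) * (√(T : ℝ) • Z) = 1 := by
    calc Utᵀ * ((√(T : ℝ))⁻¹ • (Ut * Utᵀ * X)) * (√(T : ℝ) • Z)
        = Utᵀ * Ut * (Utᵀ * (X * Z)) := by
          simp only [Matrix.mul_smul, Matrix.smul_mul, smul_smul, mul_inv_cancel₀ hw, one_smul,
            Matrix.mul_assoc]
      _ = 1 := by rw [← hZ, hUt.left_orthonormal, Matrix.one_mul]
  have hs := hsvd.pos_of_mul_mul_eq_one hinv
  have hfac : (√(T : ℝ))⁻¹ • (Ut * Utᵀ * X) = Ut * ((√(T : ℝ))⁻¹ • (Utᵀ * X)) := by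
    rw [Matrix.mul_smul, Matrix.mul_assoc]
  rw [hsvd.proj_eq hs hUt.left_orthonormal hfac]
  exact ⟨hsvd, hsvd.eq_of_eq_mul hs hUt.left_orthonormal hfac⟩

end WeightedPCA

section FactorsAndLoadings

lemma transpose_mul_self_inv_sqrt_smul {m n : Type*} [Fintype m] {c : ℝ} (hc : 0 ≤ c)
    (F : Matrix m n ℝ) :
    ((√c)⁻¹ • F)ᵀ * ((√c)⁻¹ • F) = c⁻¹ • (Fᵀ * F) := by
  rw [transpose_smul, Matrix.smul_mul, Matrix.mul_smul, smul_smul, ← mul_inv,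
    Real.mul_self_sqrt hc]

variable {m n : Type*} [Fintype m] [Fintype n] [DecidableEq n]

lemma norm_le_two_of_norm_gram_sub_one_le {P : Matrix m n ℝ} (hP : ‖Pᵀ * P - 1‖ ≤ 1 / 2) :
    ‖P‖ ≤ 2 := by
  have hgram : ‖P‖ * ‖P‖ ≤ 1 / 2 + 1 := by
    rw [← l2_opNorm_transpose_mul_self, ← sub_add_cancel (Pᵀ * P) 1]
    exact (norm_add_le _ _).trans (add_le_add hP l2_opNorm_one_le)
  nlinarith [norm_nonneg P]

lemma exists_transpose_mul_eq_one_of_norm_gram_sub_one_le {P : Matrix m n ℝ}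
    (hP : ‖Pᵀ * P - 1‖ ≤ 1 / 2) : ∃ W : Matrix m n ℝ, Pᵀ * W = 1 ∧ ‖W‖ ≤ 2 := by
  obtain ⟨G, hG, hGinv⟩ := exists_unit_eq_norm_inv_le (1 : (Matrix n n ℝ)ˣ) (σ := 1)
    one_half_pos.le one_half_lt_one (by simpa using l2_opNorm_one_le) hP
  set H : Matrix n n ℝ := ↑G⁻¹
  have hPH : Pᵀ * (P * H) = 1 := by rw [← Matrix.mul_assoc, ← hG, Units.mul_inv]
  refine ⟨P * H, hPH, ?_⟩
  have hsq : ‖P * H‖ * ‖P * H‖ ≤ 2 := by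
    calc ‖P * H‖ * ‖P * H‖ = ‖Hᵀ * (Pᵀ * (P * H))‖ := by
          rw [← l2_opNorm_transpose_mul_self, transpose_mul, Matrix.mul_assoc]
      _ = ‖H‖ := by rw [hPH, Matrix.mul_one, l2_opNorm_transpose]
      _ ≤ 2 := hGinv.trans_eq (by norm_num)
  nlinarith [norm_nonneg (P * H)]

lemma exists_orthonormal_mul_diagonal {L : Matrix m n ℝ} {lam : n → ℝ}
    (hL : Lᵀ * L = diagonal fun j => lam j ^ 2) (hlam : ∀ j, 0 < lam j) :
    ∃ Y : Matrix m n ℝ, Yᵀ * Y = 1 ∧ L = Y * diagonal lam := by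
  have hinv := diagonal_mul_diagonal_inv hlam
  refine ⟨L * diagonal lam⁻¹, ?_, ?_⟩
  · have hsq : (diagonal fun j => lam j ^ 2) = diagonal lam * diagonal lam := by
      simp only [diagonal_mul_diagonal, sq]
    rw [transpose_mul, diagonal_transpose, Matrix.mul_assoc, ← Matrix.mul_assoc Lᵀ, hL, hsq,
      Matrix.mul_assoc (diagonal lam), hinv, Matrix.mul_one, mul_eq_one_comm.1 hinv]
  · rw [Matrix.mul_assoc, mul_eq_one_comm.1 hinv, Matrix.mul_one]

end FactorsAndLoadings

lemma norm_mul_diagonal_mul_transpose_le {m n k : Type*} [Fintype m] [Fintype n] [Fintype k]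
    [DecidableEq n] [DecidableEq k] {Y : Matrix m n ℝ} {P : Matrix k n ℝ} {lam : n → ℝ} {l₁ : ℝ}
    (hY : Yᵀ * Y = 1) (hP : ‖Pᵀ * P - 1‖ ≤ 1 / 2) (hl₁ : 0 ≤ l₁) (hlam0 : ∀ j, 0 ≤ lam j)
    (hlam : ∀ j, lam j ≤ l₁) : ‖Y * diagonal lam * Pᵀ‖ ≤ 2 * l₁ := by
  rw [Matrix.mul_assoc, l2_opNorm_orthonormal_mul hY]
  calc ‖diagonal lam * Pᵀ‖ ≤ ‖diagonal lam‖ * ‖Pᵀ‖ := l2_opNorm_mul _ _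
    _ ≤ l₁ * 2 := by
        rw [l2_opNorm_transpose]
        gcongr
        exacts [l2_opNorm_diagonal_le hl₁ hlam0 hlam, norm_le_two_of_norm_gram_sub_one_le hP]
    _ = 2 * l₁ := mul_comm _ _

lemma IsTruncSVD.half_le_of_factorization {m n r : ℕ} {Y U : Matrix (Fin m) (Fin r) ℝ}
    {P V : Matrix (Fin n) (Fin r) ℝ} {lam s : Fin r → ℝ}
    (h : IsTruncSVD (Y * diagonal lam * Pᵀ) U s V) (hY : Yᵀ * Y = 1)
    (hP : ‖Pᵀ * P - 1‖ ≤ 1 / 2) {σ : ℝ} (hσ : 0 < σ) (hlam : ∀ j, σ ≤ lam j) (i : Fin r) :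
    σ / 2 ≤ s i := by
  obtain ⟨W, hPW, hW⟩ := exists_transpose_mul_eq_one_of_norm_gram_sub_one_le hP
  have hinv := mul_eq_one_comm.1 (diagonal_mul_diagonal_inv fun j => hσ.trans_le (hlam j))
  have hone : diagonal lam⁻¹ * Yᵀ * (Y * diagonal lam * Pᵀ) * W = 1 := by
    calc diagonal lam⁻¹ * Yᵀ * (Y * diagonal lam * Pᵀ) * W
        = diagonal lam⁻¹ * (Yᵀ * Y) * diagonal lam * (Pᵀ * W) := by simp only [Matrix.mul_assoc]
      _ = 1 := by rw [hY, hPW, Matrix.mul_one, Matrix.mul_one, hinv]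
  have hs := h.pos_of_mul_mul_eq_one hone
  have hB : ‖diagonal lam⁻¹ * Yᵀ‖ ≤ σ⁻¹ := by
    rw [← l2_opNorm_transpose, transpose_mul, transpose_transpose, diagonal_transpose,
      l2_opNorm_orthonormal_mul hY]
    exact l2_opNorm_diagonal_inv_le hσ hlam
  rw [← inv_le_inv₀ (hs i) (half_pos hσ)]
  calc (s i)⁻¹ ≤ ‖W‖ * ‖diagonal lam⁻¹ * Yᵀ‖ :=
        h.inv_le_of_mul_mul_eq_one (h.eq_of_eq_mul hs hY (Matrix.mul_assoc _ _ _)) hone i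
    _ ≤ 2 * σ⁻¹ := by gcongr
    _ = (σ / 2)⁻¹ := by rw [inv_div, div_eq_mul_inv]

section Deterministic

lemma norm_mul_add_sub_le {m n : Type*} [Fintype m] [Fintype n] [DecidableEq m] [DecidableEq n]
    {P P' : Matrix m m ℝ} {S E : Matrix m n ℝ} (hP : P * S = S) :
    ‖P' * (S + E) - S‖ ≤ ‖P' - P‖ * (‖S‖ + ‖E‖) + ‖P * E‖ := by
  have hsplit : P' * (S + E) - S = (P' - P) * (S + E) + P * E := by
    rw [Matrix.sub_mul, Matrix.mul_add P, hP]
    abel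
  rw [hsplit]
  refine (norm_add_le _ _).trans (add_le_add_left ((l2_opNorm_mul _ _).trans ?_) _)
  gcongr
  exact norm_add_le _ _

variable {N T r : ℕ} {S_C : Matrix (Fin N) (Fin N) ℝ} {S_T : Matrix (Fin T) (Fin T) ℝ}

lemma mul_add_le_mul_errV {l₁ ξ K : ℝ} (hl₁ : 0 ≤ l₁) (hξ : 0 ≤ ξ) (hK : 0 ≤ K) :
    ξ * (2 * l₁ * √(T : ℝ) + K * √(max N T : ℝ) * (‖CFC.sqrt S_T‖ * ‖CFC.sqrt S_C‖))
        + K * √(T : ℝ) * (‖CFC.sqrt S_T‖ * ‖CFC.sqrt S_C‖)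
      ≤ (2 + K) * errV l₁ S_C S_T ξ := by
  have hnoise : 0 ≤ (√(T : ℝ) + √(max N T : ℝ) * ξ) * (‖CFC.sqrt S_T‖ * ‖CFC.sqrt S_C‖) := by
    positivity
  have hsignal : 0 ≤ K * (l₁ * √(T : ℝ) * ξ) := by positivity
  rw [errV]
  linarith

lemma sqrt_mul_norm_sub_le {M E : Matrix (Fin N) (Fin T) ℝ} {P P' : Matrix (Fin N) (Fin N) ℝ}
    {l₁ K : ℝ} (hT : 0 < T) (hl₁ : 0 ≤ l₁) (hK : 0 ≤ K) (hPM : P * M = M) (hM : ‖M‖ ≤ 2 * l₁)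
    (hE : ‖E‖ ≤ K * √(max N T : ℝ) * (‖CFC.sqrt S_T‖ * ‖CFC.sqrt S_C‖))
    (hPE : ‖P * E‖ ≤ K * √(T : ℝ) * (‖CFC.sqrt S_T‖ * ‖CFC.sqrt S_C‖)) :
    √(T : ℝ) * ‖(√(T : ℝ))⁻¹ • (P' * (√(T : ℝ) • M + E)) - M‖
      ≤ (2 + K) * errV l₁ S_C S_T ‖P' - P‖ := by
  have hw : 0 < √(T : ℝ) := by positivity
  have hscale : √(T : ℝ) * ‖(√(T : ℝ))⁻¹ • (P' * (√(T : ℝ) • M + E)) - M‖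
      = ‖P' * (√(T : ℝ) • M + E) - √(T : ℝ) • M‖ := by
    rw [← Real.norm_of_nonneg hw.le, ← norm_smul, Real.norm_of_nonneg hw.le, smul_sub,
      smul_inv_smul₀ hw.ne']
  have hPS : P * (√(T : ℝ) • M) = √(T : ℝ) • M := by rw [Matrix.mul_smul, hPM]
  have hS : ‖√(T : ℝ) • M‖ ≤ 2 * l₁ * √(T : ℝ) := by
    rw [norm_smul, Real.norm_of_nonneg hw.le, mul_comm]
    gcongr
  calc √(T : ℝ) * ‖(√(T : ℝ))⁻¹ • (P' * (√(T : ℝ) • M + E)) - M‖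
      ≤ ‖P' - P‖ * (‖√(T : ℝ) • M‖ + ‖E‖) + ‖P * E‖ := hscale.trans_le (norm_mul_add_sub_le hPS)
    _ ≤ _ := by gcongr
    _ ≤ (2 + K) * errV l₁ S_C S_T ‖P' - P‖ := mul_add_le_mul_errV hl₁ (norm_nonneg _) hK

lemma norm_right_proj_sub_le_mul_errV_of_gram {Y U Uhat : Matrix (Fin N) (Fin r) ℝ}
    {P V Vhat : Matrix (Fin T) (Fin r) ℝ} {lam s shat : Fin r → ℝ} {M E : Matrix (Fin N) (Fin T) ℝ}
    {Q : Matrix (Fin T) (Fin T) ℝ} {l₁ lᵣ K : ℝ} (hT : 0 < T) (hK : 0 ≤ K) (hY : Yᵀ * Y = 1)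
    (hl₁ : 0 ≤ l₁) (hlᵣ : 0 < lᵣ) (hlam₁ : ∀ j, lam j ≤ l₁) (hlamᵣ : ∀ j, lᵣ ≤ lam j)
    (hP : ‖Pᵀ * P - 1‖ ≤ 1 / 2) (hM : M = Y * diagonal lam * Pᵀ) (hQ : r ≤ Q.rank)
    (hE : ‖E‖ ≤ K * √(max N T : ℝ) * (‖CFC.sqrt S_T‖ * ‖CFC.sqrt S_C‖))
    (hYE : ‖Yᵀ * E‖ ≤ K * √(T : ℝ) * (‖CFC.sqrt S_T‖ * ‖CFC.sqrt S_C‖))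
    (hX : HasOneSidedInverse (√(T : ℝ) • M + E))
    (h : IsTruncSVD M U s V) (hhat : IsWeightedPCA (√(T : ℝ) • M + E) Q Uhat shat Vhat)
    (herr : 4 * (2 + K) * errV l₁ S_C S_T ‖Uhat * Uhatᵀ - U * Uᵀ‖ ≤ lᵣ * √(T : ℝ)) :
    ‖Vhat * Vhatᵀ - V * Vᵀ‖
      ≤ 6 * (2 + K) * (errV l₁ S_C S_T ‖Uhat * Uhatᵀ - U * Uᵀ‖ / (lᵣ * √(T : ℝ))) := by
  have hw : 0 < √(T : ℝ) := by positivity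
  have hs := (hM ▸ h).half_le_of_factorization hY hP hlᵣ hlamᵣ
  have hspos : ∀ i, 0 < s i := fun i => (half_pos hlᵣ).trans_le (hs i)
  have hMY : M = Y * (diagonal lam * Pᵀ) := hM.trans (Matrix.mul_assoc _ _ _)
  have hproj : U * Uᵀ = Y * Yᵀ := h.proj_eq hspos hY hMY
  have hPM : U * Uᵀ * M = M := by
    rw [hproj, hMY, Matrix.mul_assoc, ← Matrix.mul_assoc Yᵀ, hY, Matrix.one_mul]
  have hPE : ‖U * Uᵀ * E‖ ≤ K * √(T : ℝ) * (‖CFC.sqrt S_T‖ * ‖CFC.sqrt S_C‖) := by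
    rwa [hproj, Matrix.mul_assoc, l2_opNorm_orthonormal_mul hY]
  have hMnorm : ‖M‖ ≤ 2 * l₁ := hM ▸ norm_mul_diagonal_mul_transpose_le hY hP hl₁
    (fun j => hlᵣ.le.trans (hlamᵣ j)) hlam₁
  have hdiff := sqrt_mul_norm_sub_le (P' := Uhat * Uhatᵀ) hT hl₁ hK hPM hMnorm hE hPE
  obtain ⟨hsvd, hexact⟩ := hhat.isTruncSVD_and_eq hT hQ hX
  set M' := (√(T : ℝ))⁻¹ • (Uhat * Uhatᵀ * (√(T : ℝ) • M + E))
  have hclose : ‖M' - M‖ ≤ lᵣ / 2 / 2 := by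
    refine le_of_mul_le_mul_left ?_ hw
    linarith
  calc ‖Vhat * Vhatᵀ - V * Vᵀ‖ ≤ 3 * ‖M' - M‖ / (lᵣ / 2) :=
        h.norm_right_proj_sub_le (h.eq_of_eq_mul hspos hY hMY) hsvd hexact (half_pos hlᵣ) hs hclose
    _ = 6 * (√(T : ℝ) * ‖M' - M‖) / (lᵣ * √(T : ℝ)) := by field_simp; ring
    _ ≤ 6 * ((2 + K) * errV l₁ S_C S_T ‖Uhat * Uhatᵀ - U * Uᵀ‖) / (lᵣ * √(T : ℝ)) := by gcongr
    _ = _ := by ring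

lemma norm_right_proj_sub_le_mul_errV {L Y U Uhat : Matrix (Fin N) (Fin r) ℝ}
    {F V Vhat : Matrix (Fin T) (Fin r) ℝ} {lam s shat : Fin r → ℝ} {E : Matrix (Fin N) (Fin T) ℝ}
    {Q : Matrix (Fin T) (Fin T) ℝ} {l₁ lᵣ K : ℝ} (hT : 0 < T) (hK : 0 ≤ K) (hY : Yᵀ * Y = 1)
    (hL : L = Y * diagonal lam) (hl₁ : 0 ≤ l₁) (hlᵣ : 0 < lᵣ) (hlam₁ : ∀ j, lam j ≤ l₁)
    (hlamᵣ : ∀ j, lᵣ ≤ lam j) (hF : ‖(T : ℝ)⁻¹ • (Fᵀ * F) - 1‖ ≤ 1 / 2) (hQ : r ≤ Q.rank)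
    (hE : ‖E‖ ≤ K * √(max N T : ℝ) * (‖CFC.sqrt S_T‖ * ‖CFC.sqrt S_C‖))
    (hYE : ‖Yᵀ * E‖ ≤ K * √(T : ℝ) * (‖CFC.sqrt S_T‖ * ‖CFC.sqrt S_C‖))
    (hX : HasOneSidedInverse (dataMatrix L F E))
    (h : IsTruncSVD ((√(T : ℝ))⁻¹ • (L * Fᵀ)) U s V)
    (hhat : IsWeightedPCA (dataMatrix L F E) Q Uhat shat Vhat)
    (herr : 4 * (2 + K) * errV l₁ S_C S_T ‖Uhat * Uhatᵀ - U * Uᵀ‖ ≤ lᵣ * √(T : ℝ)) :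
    ‖Vhat * Vhatᵀ - V * Vᵀ‖
      ≤ 6 * (2 + K) * (errV l₁ S_C S_T ‖Uhat * Uhatᵀ - U * Uᵀ‖ / (lᵣ * √(T : ℝ))) := by
  have hw : √(T : ℝ) ≠ 0 := by positivity
  have hP : ‖((√(T : ℝ))⁻¹ • F)ᵀ * ((√(T : ℝ))⁻¹ • F) - 1‖ ≤ 1 / 2 := by
    rwa [transpose_mul_self_inv_sqrt_smul (Nat.cast_nonneg T)]
  have hM : (√(T : ℝ))⁻¹ • (L * Fᵀ) = Y * diagonal lam * ((√(T : ℝ))⁻¹ • F)ᵀ := by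
    rw [hL, transpose_smul, Matrix.mul_smul]
  have hdata : dataMatrix L F E = √(T : ℝ) • ((√(T : ℝ))⁻¹ • (L * Fᵀ)) + E := by
    rw [smul_inv_smul₀ hw, dataMatrix]
  rw [hdata] at hX hhat
  exact norm_right_proj_sub_le_mul_errV_of_gram hT hK hY hl₁ hlᵣ hlam₁ hlamᵣ hP hM hQ hE hYE hX
    h hhat herr

end Deterministic

section Net

open Metric

variable {E F : Type*}

lemma packingNumber_half_closedBall_le [NormedAddCommGroup E] [NormedSpace ℝ E]
    [FiniteDimensional ℝ E] :
    packingNumber (1 / 2) (closedBall (0 : E) 1) ≤ 5 ^ Module.finrank ℝ E := by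
  classical
  refine iSup₂_le fun C hC => iSup_le fun hsep => ?_
  by_contra! hlt
  obtain ⟨t, htC, htcard⟩ := Set.exists_subset_encard_eq (Order.add_one_le_of_lt hlt)
  obtain ⟨s, rfl⟩ : ∃ s : Finset E, t = s :=
    ⟨_, (Set.Finite.coe_toFinset (Set.finite_of_encard_eq_coe (k := 5 ^ _ + 1)
      (by exact_mod_cast htcard))).symm⟩
  -- `Besicovitch.card_le_of_separated` asks for separation `1` inside the ball of radius `2`.
  have hcard : (s.image ((2 : ℝ) • ·)).card = s.card :=
    Finset.card_image_of_injective _ (smul_right_injective E two_ne_zero)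
  have hle := Besicovitch.card_le_of_separated (s.image ((2 : ℝ) • ·)) ?_ ?_
  · rw [Set.encard_coe_eq_coe_finsetCard] at htcard
    have : s.card = 5 ^ Module.finrank ℝ E + 1 := by exact_mod_cast htcard
    omega
  · simp only [Finset.forall_mem_image, norm_smul, Real.norm_ofNat]
    intro x hx
    linarith [mem_closedBall_zero_iff.1 (hC (htC hx))]
  · simp only [Finset.forall_mem_image, ← smul_sub, norm_smul, Real.norm_ofNat]
    intro x hx y hy hxy
    have hdist : ((1 / 2 : ℝ≥0) : ℝ≥0∞) < edist x y :=
      hsep (htC hx) (htC hy) fun h => hxy (h ▸ rfl)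
    rw [edist_nndist, ENNReal.coe_lt_coe, ← NNReal.coe_lt_coe, coe_nndist, dist_eq_norm,
      NNReal.coe_div, NNReal.coe_one, NNReal.coe_ofNat] at hdist
    linarith

lemma exists_isCover_half_closedBall [NormedAddCommGroup E] [NormedSpace ℝ E]
    [FiniteDimensional ℝ E] : ∃ s : Finset E, s.card ≤ 5 ^ Module.finrank ℝ E ∧
      ↑s ⊆ closedBall (0 : E) 1 ∧ IsCover (1 / 2) (closedBall (0 : E) 1) s := by
  have hle := (coveringNumber_le_packingNumber (1 / 2) (closedBall (0 : E) 1)).trans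
    packingNumber_half_closedBall_le
  obtain ⟨s, hs, hfin, hcover, hcard⟩ := exists_set_encard_eq_coveringNumber
    (hle.trans_lt (by exact_mod_cast ENat.natCast_lt_top (5 ^ _))).ne
  lift s to Finset E using hfin
  rw [Set.encard_coe_eq_coe_finsetCard] at hcard
  exact ⟨s, by exact_mod_cast hcard.trans_le hle, hs, hcover⟩

lemma one_sub_mul_norm_le_of_isCover [NormedAddCommGroup E] [InnerProductSpace ℝ E] {ε : ℝ≥0}
    {s : Set E} (hs : IsCover ε (closedBall 0 1) s) {v : E} {b : ℝ}
    (hb : ∀ z ∈ s, inner ℝ z v ≤ b) : (1 - ε) * ‖v‖ ≤ b := by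
  obtain ⟨x, hx, hxv⟩ : ∃ x : E, ‖x‖ ≤ 1 ∧ inner ℝ x v = ‖v‖ := by
    refine ⟨‖v‖⁻¹ • v, ?_, ?_⟩
    · rw [norm_smul, norm_inv, norm_norm]
      exact inv_mul_le_one
    · rw [real_inner_smul_left, real_inner_self_eq_norm_mul_norm, ← mul_assoc]
      exact inv_mul_mul_self _
  obtain ⟨z, hz, hxz⟩ := Set.mem_iUnion₂.1
    (isCover_iff_subset_iUnion_closedBall.1 hs (mem_closedBall_zero_iff.2 hx))
  have hdiff : inner ℝ (x - z) v ≤ ε * ‖v‖ := (real_inner_le_norm _ _).trans (by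
    gcongr
    exact mem_closedBall_iff_norm.1 hxz)
  rw [inner_sub_left, hxv] at hdiff
  linarith [hb z hz]

lemma one_sub_mul_opNorm_le_of_isCover [NormedAddCommGroup E] [NormedSpace ℝ E]
    [NormedAddCommGroup F] [NormedSpace ℝ F] {ε : ℝ≥0} {t : Set E}
    (ht : IsCover ε (closedBall 0 1) t) {A : E →L[ℝ] F} {b : ℝ} (hb : ∀ y ∈ t, ‖A y‖ ≤ b) :
    (1 - ε) * ‖A‖ ≤ b := by
  have hunit : ∀ x ∈ closedBall (0 : E) 1, ‖A x‖ ≤ b + ε * ‖A‖ := fun x hx => by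
    obtain ⟨y, hy, hxy⟩ := Set.mem_iUnion₂.1 (isCover_iff_subset_iUnion_closedBall.1 ht hx)
    calc ‖A x‖ = ‖A y + A (x - y)‖ := by rw [map_sub, add_sub_cancel]
      _ ≤ ‖A y‖ + ‖A‖ * ‖x - y‖ := (norm_add_le _ _).trans (by gcongr; exact A.le_opNorm _)
      _ ≤ b + ‖A‖ * ε := by
          gcongr
          exacts [hb y hy, mem_closedBall_iff_norm.1 hxy]
      _ = b + ε * ‖A‖ := by rw [mul_comm (ε : ℝ)]
  have hnonneg : 0 ≤ b + ε * ‖A‖ :=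
    (norm_nonneg _).trans (hunit 0 (mem_closedBall_self zero_le_one))
  have hnorm : ‖A‖ ≤ b + ε * ‖A‖ :=
    A.opNorm_le_of_unit_norm hnonneg fun x hx => hunit x (mem_closedBall_zero_iff.2 hx.le)
  linarith

lemma l2_opNorm_le_of_isCover_half {m n : Type*} [Fintype m] [Fintype n] [DecidableEq n]
    {s : Set (EuclideanSpace ℝ m)} {t : Set (EuclideanSpace ℝ n)}
    (hs : IsCover (1 / 2) (closedBall 0 1) s) (ht : IsCover (1 / 2) (closedBall 0 1) t)
    {A : Matrix m n ℝ} {b : ℝ} (hb : ∀ x ∈ s, ∀ y ∈ t, x.ofLp ⬝ᵥ A *ᵥ y.ofLp ≤ b) :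
    ‖A‖ ≤ 4 * b := by
  have hcol : ∀ y ∈ t, ‖WithLp.toLp 2 (A *ᵥ y.ofLp)‖ ≤ 2 * b := fun y hy => by
    have hnorm := one_sub_mul_norm_le_of_isCover hs (v := WithLp.toLp 2 (A *ᵥ y.ofLp)) (b := b)
      fun x hx => by
        rw [EuclideanSpace.inner_eq_star_dotProduct, dotProduct_comm]
        exact hb x hx y hy
    push_cast at hnorm
    linarith
  have hnorm := one_sub_mul_opNorm_le_of_isCover ht
    (A := (toEuclideanLin.trans LinearMap.toContinuousLinearMap) A) hcol
  rw [← l2_opNorm_def] at hnorm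
  push_cast at hnorm
  linarith

end Net

section Tail

variable {Ω : Type*} [MeasurableSpace Ω] {μ : Measure Ω}

lemma measureReal_gaussian_ge_le [IsProbabilityMeasure μ] {Z : Ω → ℝ} {v : ℝ≥0}
    (hZ : HasLaw Z (gaussianReal 0 v) μ) {κ u : ℝ} (hκ : 0 < κ) (hu : 0 ≤ u)
    (hv : (v : ℝ) ≤ κ ^ 2) : μ.real {ω | u * κ ≤ Z ω} ≤ Real.exp (-u ^ 2 / 2) := by
  have hint : Integrable (fun ω => Real.exp (u / κ * Z ω)) μ := by
    have := integrable_exp_mul_gaussianReal (μ := 0) (v := v) (u / κ)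
    rw [← hZ.map_eq] at this
    exact this.comp_aemeasurable hZ.aemeasurable
  have hmgf : mgf Z μ (u / κ) ≤ Real.exp (u ^ 2 / 2) := by
    rw [mgf_gaussianReal hZ.map_eq, zero_mul, zero_add]
    gcongr
    calc (v : ℝ) * (u / κ) ^ 2 ≤ κ ^ 2 * (u / κ) ^ 2 := by gcongr
      _ = u ^ 2 := by field_simp
  calc μ.real {ω | u * κ ≤ Z ω} ≤ Real.exp (-(u / κ) * (u * κ)) * mgf Z μ (u / κ) :=
        measure_ge_le_exp_mul_mgf _ (div_nonneg hu hκ.le) hint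
    _ ≤ Real.exp (-(u / κ) * (u * κ)) * Real.exp (u ^ 2 / 2) := by gcongr
    _ = Real.exp (-u ^ 2 / 2) := by
        rw [← Real.exp_add]
        congr 1
        field_simp
        ring

section SquareRoot

variable {n : Type*} [Fintype n] [DecidableEq n] {S : Matrix n n ℝ}

lemma dotProduct_mulVec_eq_norm_sqrt_sq (hS : S.PosSemidef) (x : n → ℝ) :
    x ⬝ᵥ S *ᵥ x = ‖WithLp.toLp 2 (CFC.sqrt S *ᵥ x)‖ ^ 2 := by
  have hsymm : (CFC.sqrt S)ᵀ = CFC.sqrt S := by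
    rw [← conjTranspose_eq_transpose_of_trivial]
    exact (CFC.sqrt_nonneg S).isSelfAdjoint.star_eq
  calc x ⬝ᵥ S *ᵥ x = (CFC.sqrt S *ᵥ x) ⬝ᵥ (CFC.sqrt S *ᵥ x) := by
        conv_lhs => rw [← CFC.sqrt_mul_sqrt_self S hS.nonneg, ← mulVec_mulVec, dotProduct_mulVec,
          ← mulVec_transpose, hsymm]
    _ = ‖WithLp.toLp 2 (CFC.sqrt S *ᵥ x)‖ ^ 2 := by
        rw [EuclideanSpace.real_norm_sq_eq]
        simp only [dotProduct, sq]

lemma dotProduct_mulVec_le_norm_sqrt_sq (hS : S.PosSemidef) {x : EuclideanSpace ℝ n}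
    (hx : ‖x‖ ≤ 1) : x.ofLp ⬝ᵥ S *ᵥ x.ofLp ≤ ‖CFC.sqrt S‖ ^ 2 := by
  rw [dotProduct_mulVec_eq_norm_sqrt_sq hS]
  gcongr
  exact (l2_opNorm_mulVec _ x).trans (mul_le_of_le_one_right (norm_nonneg _) hx)

lemma isUnit_sqrt_of_posDef (hS : S.PosDef) : IsUnit (CFC.sqrt S) := by
  have h := hS.isUnit
  rw [← CFC.sqrt_mul_sqrt_self S hS.posSemidef.nonneg] at h
  exact ((Commute.refl _).isUnit_mul_iff.1 h).1

lemma norm_sqrt_pos [Nonempty n] (hS : S.PosDef) : 0 < ‖CFC.sqrt S‖ :=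
  norm_pos_iff.2 (isUnit_sqrt_of_posDef hS).ne_zero

lemma hasLaw_inner_multivariateGaussian (hS : S.PosSemidef) (w : EuclideanSpace ℝ n) :
    HasLaw (fun z => inner ℝ w z) (gaussianReal 0 (w.ofLp ⬝ᵥ S *ᵥ w.ofLp).toNNReal)
      (multivariateGaussian 0 S) := by
  refine ⟨(innerSL ℝ w).continuous.aemeasurable, ?_⟩
  have hmean : ∫ z, innerSL ℝ w z ∂multivariateGaussian 0 S = 0 := by
    rw [(innerSL ℝ w).integral_comp_id_comm IsGaussian.integrable_id,
      integral_id_multivariateGaussian, map_zero]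
  have hvar : Var[innerSL ℝ w; multivariateGaussian 0 S] = w.ofLp ⬝ᵥ S *ᵥ w.ofLp := by
    rw [← covarianceBilin_multivariateGaussian hS w w]
    exact (covarianceBilin_self IsGaussian.memLp_two_id w).symm
  change (multivariateGaussian 0 S).map (innerSL ℝ w) = _
  rw [IsGaussian.map_eq_gaussianReal, hmean, hvar]

end SquareRoot

lemma dotProduct_kronecker_mulVec {m n : Type*} [Fintype m] [Fintype n] (A : Matrix m m ℝ)
    (B : Matrix n n ℝ) (x : m → ℝ) (y : n → ℝ) :
    (fun p : m × n => x p.1 * y p.2) ⬝ᵥ (A ⊗ₖ B) *ᵥ (fun p => x p.1 * y p.2)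
      = (x ⬝ᵥ A *ᵥ x) * (y ⬝ᵥ B *ᵥ y) := by
  simp only [dotProduct, mulVec, Fintype.sum_prod_type, kroneckerMap_apply, Finset.sum_mul_sum,
    mul_mul_mul_comm]

namespace SeparableGaussian

variable {N T : ℕ} {E : Ω → Matrix (Fin N) (Fin T) ℝ} {S_C : Matrix (Fin N) (Fin N) ℝ}
  {S_T : Matrix (Fin T) (Fin T) ℝ}

lemma hasLaw_dotProduct_mulVec (hE : SeparableGaussian μ E S_C S_T) (hC : S_C.PosSemidef)
    (hT : S_T.PosSemidef) (x : Fin N → ℝ) (y : Fin T → ℝ) :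
    HasLaw (fun ω => x ⬝ᵥ E ω *ᵥ y)
      (gaussianReal 0 ((x ⬝ᵥ S_C *ᵥ x) * (y ⬝ᵥ S_T *ᵥ y)).toNNReal) μ := by
  have hlaw := (hasLaw_inner_multivariateGaussian (hC.kronecker hT)
    (WithLp.toLp 2 fun p => x p.1 * y p.2)).comp hE
  rw [dotProduct_kronecker_mulVec] at hlaw
  refine hlaw.congr (Filter.Eventually.of_forall fun ω => ?_)
  simp only [Function.comp_apply, EuclideanSpace.inner_eq_star_dotProduct, star_trivial,
    Fintype.sum_prod_type, dotProduct, mulVec, Finset.mul_sum]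
  exact Finset.sum_congr rfl fun i _ => Finset.sum_congr rfl fun t _ => by ring

variable [IsProbabilityMeasure μ]

lemma measureReal_dotProduct_mulVec_ge_le (hE : SeparableGaussian μ E S_C S_T)
    (hC : S_C.PosSemidef) (hT : S_T.PosSemidef) (hκ : 0 < ‖CFC.sqrt S_T‖ * ‖CFC.sqrt S_C‖)
    {x : EuclideanSpace ℝ (Fin N)} (hx : ‖x‖ ≤ 1) {y : EuclideanSpace ℝ (Fin T)} (hy : ‖y‖ ≤ 1)
    {u : ℝ} (hu : 0 ≤ u) :
    μ.real {ω | u * (‖CFC.sqrt S_T‖ * ‖CFC.sqrt S_C‖) ≤ x.ofLp ⬝ᵥ E ω *ᵥ y.ofLp}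
      ≤ Real.exp (-u ^ 2 / 2) := by
  refine measureReal_gaussian_ge_le (hE.hasLaw_dotProduct_mulVec hC hT _ _) hκ hu ?_
  rw [Real.coe_toNNReal', mul_pow, mul_comm]
  refine max_le ?_ (by positivity)
  exact mul_le_mul (dotProduct_mulVec_le_norm_sqrt_sq hT hy)
    (dotProduct_mulVec_le_norm_sqrt_sq hC hx)
    (by simpa using hC.dotProduct_mulVec_nonneg x.ofLp) (by positivity)

lemma measureReal_norm_transpose_mul_gt_le (hE : SeparableGaussian μ E S_C S_T)
    (hC : S_C.PosSemidef) (hT : S_T.PosSemidef) (hκ : 0 < ‖CFC.sqrt S_T‖ * ‖CFC.sqrt S_C‖)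
    {m : Type*} [Fintype m] [DecidableEq m] {B : Matrix (Fin N) m ℝ} (hB : ‖B‖ ≤ 1) {u : ℝ}
    (hu : 0 ≤ u) :
    μ.real {ω | 4 * (u * (‖CFC.sqrt S_T‖ * ‖CFC.sqrt S_C‖)) < ‖Bᵀ * E ω‖}
      ≤ 5 ^ (Fintype.card m + T) * Real.exp (-u ^ 2 / 2) := by
  set κ := ‖CFC.sqrt S_T‖ * ‖CFC.sqrt S_C‖
  obtain ⟨s, hscard, hsball, hs⟩ := exists_isCover_half_closedBall (E := EuclideanSpace ℝ m)
  obtain ⟨t, htcard, htball, ht⟩ := exists_isCover_half_closedBall (E := EuclideanSpace ℝ (Fin T))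
  rw [finrank_euclideanSpace] at hscard htcard
  have hsub : {ω | 4 * (u * κ) < ‖Bᵀ * E ω‖} ⊆
      ⋃ p ∈ s ×ˢ t, {ω | u * κ ≤ (B *ᵥ p.1.ofLp) ⬝ᵥ E ω *ᵥ p.2.ofLp} := by
    intro ω hω
    by_contra hnot
    simp only [Set.mem_iUnion, not_exists, Set.mem_ofPred_eq, not_le] at hnot
    refine (not_le.2 hω) (l2_opNorm_le_of_isCover_half hs ht fun x hx y hy => ?_)
    rw [← mulVec_mulVec, dotProduct_mulVec, vecMul_transpose]
    exact (hnot (x, y) (Finset.mk_mem_product hx hy)).le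
  have htail : ∀ p ∈ s ×ˢ t, μ.real {ω | u * κ ≤ (B *ᵥ p.1.ofLp) ⬝ᵥ E ω *ᵥ p.2.ofLp}
      ≤ Real.exp (-u ^ 2 / 2) := fun p hp => by
    obtain ⟨hp₁, hp₂⟩ := Finset.mem_product.1 hp
    refine hE.measureReal_dotProduct_mulVec_ge_le hC hT hκ (x := WithLp.toLp 2 (B *ᵥ p.1.ofLp))
      ((l2_opNorm_mulVec B p.1).trans ?_) (mem_closedBall_zero_iff.1 (htball hp₂)) hu
    exact mul_le_one₀ hB (norm_nonneg _) (mem_closedBall_zero_iff.1 (hsball hp₁))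
  calc μ.real {ω | 4 * (u * κ) < ‖Bᵀ * E ω‖}
      ≤ ∑ p ∈ s ×ˢ t, μ.real {ω | u * κ ≤ (B *ᵥ p.1.ofLp) ⬝ᵥ E ω *ᵥ p.2.ofLp} :=
        (measureReal_mono hsub (measure_ne_top _ _)).trans (measureReal_biUnion_finset_le _ _)
    _ ≤ (s.card * t.card : ℕ) * Real.exp (-u ^ 2 / 2) := by
        rw [← Finset.card_product, ← nsmul_eq_mul]
        exact Finset.sum_le_card_nsmul _ _ _ htail
    _ ≤ 5 ^ (Fintype.card m + T) * Real.exp (-u ^ 2 / 2) := by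
        gcongr
        rw [pow_add]
        rw [Fintype.card_fin] at htcard
        exact_mod_cast Nat.mul_le_mul hscard htcard

end SeparableGaussian

end Tail

section AbsolutelyContinuous

lemma pi_fin_absolutelyContinuous : ∀ {n : ℕ} {α : Fin n → Type*} [∀ i, MeasurableSpace (α i)]
    {μ ν : ∀ i, Measure (α i)} [∀ i, SigmaFinite (μ i)] [∀ i, SigmaFinite (ν i)],
    (∀ i, μ i ≪ ν i) → Measure.pi μ ≪ Measure.pi ν
  | 0, _, _, μ, ν, _, _, _ => by rw [Measure.pi_of_empty, Measure.pi_of_empty]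
  | n + 1, _, _, μ, ν, _, _, h => by
    rw [← (measurePreserving_piFinSuccAbove μ 0).symm.map_eq,
      ← (measurePreserving_piFinSuccAbove ν 0).symm.map_eq]
    exact ((h 0).prod (pi_fin_absolutelyContinuous fun i => h (Fin.succAbove 0 i))).map
      (MeasurableEquiv.measurable _)

variable {ι : Type*} [Fintype ι]

lemma pi_absolutelyContinuous {α : ι → Type*} [∀ i, MeasurableSpace (α i)]
    {μ ν : ∀ i, Measure (α i)} [∀ i, SigmaFinite (μ i)] [∀ i, SigmaFinite (ν i)]
    (h : ∀ i, μ i ≪ ν i) : Measure.pi μ ≪ Measure.pi ν := by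
  let e := (Fintype.equivFin ι).symm
  rw [← (measurePreserving_piCongrLeft μ e).map_eq, ← (measurePreserving_piCongrLeft ν e).map_eq]
  exact (pi_fin_absolutelyContinuous fun i => h (e i)).map (MeasurableEquiv.measurable _)

lemma stdGaussian_absolutelyContinuous :
    stdGaussian (EuclideanSpace ℝ ι) ≪ (volume : Measure (EuclideanSpace ℝ ι)) := by
  rw [← map_pi_eq_stdGaussian, ← (PiLp.volume_preserving_toLp ι).map_eq]
  exact (pi_absolutelyContinuous fun _ => gaussianReal_absolutelyContinuous 0 one_ne_zero).map
    (by fun_prop)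

variable [DecidableEq ι]

lemma multivariateGaussian_absolutelyContinuous {S : Matrix ι ι ℝ} (hS : S.PosDef)
    (m : EuclideanSpace ℝ ι) : multivariateGaussian m S ≪ volume := by
  set f := Matrix.toEuclideanCLM (n := ι) (𝕜 := ℝ) (CFC.sqrt S)
  have hdet : f.det ≠ 0 :=
    ((LinearMap.isUnit_iff_isUnit_det _).1 (((isUnit_sqrt_of_posDef hS).map
      (Matrix.toEuclideanCLM (n := ι) (𝕜 := ℝ))).map
      (ContinuousLinearMap.toLinearMapRingHom (R₁ := ℝ) (M₁ := EuclideanSpace ℝ ι)))).ne_zero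
  have hquasi : Measure.QuasiMeasurePreserving (fun x => m + f x) volume volume :=
    (quasiMeasurePreserving_add_left volume m).comp
      (Measure.ContinuousLinearMap.quasiMeasurePreserving volume f hdet)
  exact (stdGaussian_absolutelyContinuous.map hquasi.measurable).trans
    hquasi.absolutelyContinuous

end AbsolutelyContinuous

section FullRank

variable {m n k : Type*} [Fintype k] [DecidableEq k]

lemma finite_setOf_det_add_smul_one_eq_zero {R : Type*} [CommRing R] [IsDomain R]
    (A : Matrix k k R) : {x : R | (A + x • (1 : Matrix k k R)).det = 0}.Finite := by
  classical
  refine (-A).charpoly.roots.toFinset.finite_toSet.subset fun x hx => ?_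
  simpa [(-A).charpoly_monic.ne_zero, Matrix.eval_charpoly, Matrix.smul_one_eq_diagonal,
    add_comm] using hx

variable [Fintype m] [Fintype n]

lemma ae_det_submatrix_ne_zero {e : k → m} {e' : k → n} (he : Function.Injective e)
    (he' : Function.Injective e') :
    ∀ᵐ g : EuclideanSpace ℝ (m × n), ((Matrix.of fun i t => g (i, t)).submatrix e e').det ≠ 0 := by
  classical
  let B : EuclideanSpace ℝ (m × n) :=
    WithLp.toLp 2 fun p => if ∃ a, p.1 = e a ∧ p.2 = e' a then 1 else 0
  have hcont : Continuous fun g : EuclideanSpace ℝ (m × n) =>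
      ((Matrix.of fun i t => g (i, t)).submatrix e e').det :=
    Continuous.matrix_det (continuous_matrix fun a b => by
      simp only [Matrix.submatrix_apply, Matrix.of_apply]
      fun_prop)
  -- On each line in direction `B` the minor is, up to sign, a shifted characteristic polynomial.
  have hline (y : EuclideanSpace ℝ (m × n)) (x : ℝ) :
      (Matrix.of fun i t => (y + x • B) (i, t)).submatrix e e'
        = (Matrix.of fun i t => y (i, t)).submatrix e e' + x • 1 := by
    ext a b
    have hab : (∃ c, e a = e c ∧ e' b = e' c) ↔ a = b :=
      ⟨fun ⟨c, h, h'⟩ => (he h).trans (he' h').symm, fun h => ⟨a, rfl, h ▸ rfl⟩⟩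
    simp [B, hab, Matrix.one_apply]
  refine ae_mem_of_ae_add_linearMap_mem (LinearMap.toSpanSingleton ℝ _ B) volume volume
    (s := {g | ((Matrix.of fun i t => g (i, t)).submatrix e e').det ≠ 0})
    (hcont.measurable (measurableSet_singleton 0).compl) fun y => ?_
  refine measure_mono_null (fun x hx => ?_) ((finite_setOf_det_add_smul_one_eq_zero
    ((Matrix.of fun i t => y (i, t)).submatrix e e')).measure_zero _)
  exact (congrArg Matrix.det (hline y x)).symm.trans (not_not.1 hx)

lemma exists_right_inverse_of_submatrix {R : Type*} [CommRing R] [DecidableEq m]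
    {X : Matrix m n R} {e : m → n} (h : IsUnit (X.submatrix id e).det) :
    ∃ W : Matrix n m R, X * W = 1 := by
  classical
  refine ⟨(1 : Matrix n n R).submatrix (Equiv.refl n) e * (X.submatrix id e)⁻¹, ?_⟩
  rw [← Matrix.mul_assoc, Matrix.mul_submatrix_one]
  exact Matrix.mul_nonsing_inv _ h

variable {N T : ℕ}

lemma ae_exists_inverse : ∀ᵐ g : EuclideanSpace ℝ (Fin N × Fin T),
    HasOneSidedInverse (Matrix.of fun i t => g (i, t)) := by
  rcases le_total N T with hNT | hTN
  · filter_upwards [ae_det_submatrix_ne_zero Function.injective_id (Fin.castLE_injective hNT)]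
      with g hg
    exact .inl (exists_right_inverse_of_submatrix hg.isUnit)
  · filter_upwards [ae_det_submatrix_ne_zero (Fin.castLE_injective hTN) Function.injective_id]
      with g hg
    obtain ⟨W, hW⟩ := exists_right_inverse_of_submatrix (e := Fin.castLE hTN)
      (X := (Matrix.of fun i t => g (i, t))ᵀ)
      (by rw [← Matrix.transpose_submatrix, Matrix.det_transpose]; exact hg.isUnit)
    exact .inr ⟨Wᵀ, by simpa using congrArg Matrix.transpose hW⟩

lemma SeparableGaussian.ae_exists_inverse_dataMatrix {Ω : Type*} [MeasurableSpace Ω]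
    {μ : Measure Ω} [IsFiniteMeasure μ] {r : ℕ} {E : Ω → Matrix (Fin N) (Fin T) ℝ}
    {S_C : Matrix (Fin N) (Fin N) ℝ} {S_T : Matrix (Fin T) (Fin T) ℝ}
    (hE : SeparableGaussian μ E S_C S_T) (hC : S_C.PosDef) (hT : S_T.PosDef)
    (L : Matrix (Fin N) (Fin r) ℝ) {F : Ω → Matrix (Fin T) (Fin r) ℝ}
    (hF : ∀ t j, AEMeasurable (fun ω => F ω t j) μ)
    (hind : IndepFun (fun ω (p : Fin T × Fin r) => F ω p.1 p.2)
      (fun ω (p : Fin N × Fin T) => E ω p.1 p.2) μ) :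
    ∀ᵐ ω ∂μ, HasOneSidedInverse (dataMatrix L (F ω) (E ω)) := by
  let low (f : Fin T × Fin r → ℝ) : EuclideanSpace ℝ (Fin N × Fin T) :=
    WithLp.toLp 2 fun p => ∑ j, L p.1 j * f (p.2, j)
  have hlow : Measurable low := by fun_prop
  have hlowF : AEMeasurable (fun ω => low fun p => F ω p.1 p.2) μ :=
    hlow.comp_aemeasurable (aemeasurable_pi_lambda _ fun p => hF p.1 p.2)
  have hac : μ.map ((fun ω => low fun p => F ω p.1 p.2) +
      fun ω => WithLp.toLp 2 fun p : Fin N × Fin T => E ω p.1 p.2) ≪ volume := by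
    rw [(hind.comp hlow (WithLp.measurable_toLp 2 _)).map_add_eq_map_conv_map₀ hlowF
      hE.aemeasurable, HasLaw.map_eq hE]
    exact Measure.conv_absolutelyContinuous
      (multivariateGaussian_absolutelyContinuous (hC.kronecker hT) 0)
  exact ae_of_ae_map (hlowF.add hE.aemeasurable) (hac.ae_le ae_exists_inverse)

end FullRank

section Event

lemma le_of_transpose_mul_self_eq_one {m n : ℕ} {U : Matrix (Fin m) (Fin n) ℝ} (hU : Uᵀ * U = 1) :
    n ≤ m := by
  have h := Matrix.rank_mul_le_right Uᵀ U
  rw [hU, Matrix.rank_one, Fintype.card_fin] at h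
  exact h.trans (Matrix.rank_le_height U)

lemma five_pow_mul_exp_neg_le {m : ℕ} {x b : ℝ} (hm : (m : ℝ) ≤ 2 * x) :
    5 ^ m * Real.exp (-((2 * Real.log 5 + b) * x)) ≤ Real.exp (-(b * x)) := by
  have hlog : 0 ≤ Real.log 5 := Real.log_nonneg (by norm_num)
  have hpow : (5 : ℝ) ^ m = Real.exp (m * Real.log 5) := by
    rw [Real.exp_nat_mul, Real.exp_log (by norm_num)]
  rw [hpow, ← Real.exp_add, Real.exp_le_exp]
  linarith [mul_le_mul_of_nonneg_right hm hlog]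

lemma exp_neg_mul_le_zpow {x y : ℝ} {k : ℤ} (hx : 0 < x) (hk : 0 ≤ k) (h : Real.log x ≤ y) :
    Real.exp (-(k * y)) ≤ x ^ (-k) := by
  rw [← Real.exp_log (zpow_pos hx (-k)), Real.log_zpow, Real.exp_le_exp, Int.cast_neg, neg_mul,
    neg_le_neg_iff]
  gcongr

lemma exp_neg_add_exp_neg_le {N T : ℕ} {A a : ℝ} {k : ℤ} (hA : 0 ≤ A) (ha : 0 ≤ a) (hk : 0 ≤ k)
    (hT : 0 < T) (h : Real.log (max N T : ℝ) ≤ A * T) :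
    Real.exp (-((a + k * A) * (max N T : ℝ))) + Real.exp (-((a + k * A) * T))
      ≤ Real.exp (-a * N) + (max N T : ℝ) ^ (-k) := by
  have hn : 0 < (max N T : ℝ) := lt_max_of_lt_right (by exact_mod_cast hT)
  have hkA : 0 ≤ k * A := by positivity
  refine add_le_add (Real.exp_le_exp.2 ?_)
    ((Real.exp_le_exp.2 ?_).trans (exp_neg_mul_le_zpow hn hk h))
  · rw [neg_mul, neg_le_neg_iff]
    exact mul_le_mul (le_add_of_nonneg_right hkA) (le_max_left _ _) N.cast_nonneg (by positivity)
  · rw [neg_le_neg_iff, ← mul_assoc]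
    exact mul_le_mul_of_nonneg_right (le_add_of_nonneg_left ha) T.cast_nonneg

lemma exists_measurableSet_disjoint {Ω : Type*} [MeasurableSpace Ω] (μ : Measure Ω)
    [IsProbabilityMeasure μ] (bad : Set Ω) :
    ∃ good : Set Ω, MeasurableSet good ∧ 1 - μ.real bad = μ.real good ∧ Disjoint good bad := by
  refine ⟨(toMeasurable μ bad)ᶜ, (measurableSet_toMeasurable μ bad).compl, ?_,
    Set.disjoint_compl_left_iff_subset.2 (subset_toMeasurable μ bad)⟩
  rw [probReal_compl_eq_one_sub (measurableSet_toMeasurable μ bad), measureReal_def,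
    measureReal_def, measure_toMeasurable]

/-- The constant `K` for which `‖E‖ ≤ K √n ‖S_T^{1/2}‖ ‖S_C^{1/2}‖` fails with probability at most
`e^{-b n}`; the summand `2 log 5` pays for the `5 ^ (2 n)` pairs of net points. -/
noncomputable def noiseConst (b : ℝ) : ℝ :=
  4 * √(2 * (2 * Real.log 5 + b))

lemma noiseConst_nonneg (b : ℝ) : 0 ≤ noiseConst b := by
  unfold noiseConst
  positivity

variable {Ω : Type*} [MeasurableSpace Ω] {μ : Measure Ω} [IsProbabilityMeasure μ] {N T r : ℕ}
  {E : Ω → Matrix (Fin N) (Fin T) ℝ} {S_C : Matrix (Fin N) (Fin N) ℝ}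
  {S_T : Matrix (Fin T) (Fin T) ℝ}

lemma SeparableGaussian.measureReal_norm_transpose_mul_gt_le_exp
    (hE : SeparableGaussian μ E S_C S_T) (hC : S_C.PosSemidef) (hT : S_T.PosSemidef)
    (hκ : 0 < ‖CFC.sqrt S_T‖ * ‖CFC.sqrt S_C‖) {m : Type*} [Fintype m] [DecidableEq m]
    {B : Matrix (Fin N) m ℝ} (hB : ‖B‖ ≤ 1) {b x : ℝ} (hb : 0 ≤ b)
    (hx : Fintype.card m + T ≤ 2 * x) :
    μ.real {ω | noiseConst b * √x * (‖CFC.sqrt S_T‖ * ‖CFC.sqrt S_C‖) < ‖Bᵀ * E ω‖}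
      ≤ Real.exp (-(b * x)) := by
  have hx0 : 0 ≤ x := by
    have : (0 : ℝ) ≤ Fintype.card m + T := by positivity
    linarith
  have hβ : 0 ≤ 2 * Real.log 5 + b := by
    have := Real.log_nonneg (show (1 : ℝ) ≤ 5 by norm_num)
    positivity
  have htail := hE.measureReal_norm_transpose_mul_gt_le hC hT hκ hB
    (Real.sqrt_nonneg (2 * (2 * Real.log 5 + b) * x))
  have hexp : -√(2 * (2 * Real.log 5 + b) * x) ^ 2 / 2 = -((2 * Real.log 5 + b) * x) := by
    rw [Real.sq_sqrt (by positivity)]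
    ring
  have hscale : noiseConst b * √x = 4 * √(2 * (2 * Real.log 5 + b) * x) := by
    rw [noiseConst, Real.sqrt_mul (mul_nonneg zero_le_two hβ), mul_assoc]
  rw [hscale, mul_assoc]
  rw [hexp] at htail
  exact htail.trans (five_pow_mul_exp_neg_le (by exact_mod_cast hx))

lemma exists_good_event (hE : SeparableGaussian μ E S_C S_T) (hC : S_C.PosDef) (hT : S_T.PosDef)
    (hN0 : 0 < N) (hT0 : 0 < T) (hrT : r ≤ T) {Y : Matrix (Fin N) (Fin r) ℝ} (hY : Yᵀ * Y = 1)
    (L : Matrix (Fin N) (Fin r) ℝ) {F : Ω → Matrix (Fin T) (Fin r) ℝ}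
    (hF : ∀ t j, AEMeasurable (fun ω => F ω t j) μ)
    (hind : IndepFun (fun ω (p : Fin T × Fin r) => F ω p.1 p.2)
      (fun ω (p : Fin N × Fin T) => E ω p.1 p.2) μ) {δ η b : ℝ}
    (hconc : μ.real {ω | δ ≤ ‖(T : ℝ)⁻¹ • ((F ω)ᵀ * F ω) - 1‖} ≤ η) (hb : 0 ≤ b) :
    ∃ good : Set Ω, MeasurableSet good ∧
      1 - η - (Real.exp (-(b * (max N T : ℝ))) + Real.exp (-(b * T))) ≤ μ.real good ∧
      ∀ ω ∈ good, ‖(T : ℝ)⁻¹ • ((F ω)ᵀ * F ω) - 1‖ < δ ∧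
        ‖E ω‖ ≤ noiseConst b * √(max N T : ℝ) * (‖CFC.sqrt S_T‖ * ‖CFC.sqrt S_C‖) ∧
        ‖Yᵀ * E ω‖ ≤ noiseConst b * √(T : ℝ) * (‖CFC.sqrt S_T‖ * ‖CFC.sqrt S_C‖) ∧
        HasOneSidedInverse (dataMatrix L (F ω) (E ω)) := by
  have : NeZero N := ⟨hN0.ne'⟩
  have : NeZero T := ⟨hT0.ne'⟩
  have hκ : 0 < ‖CFC.sqrt S_T‖ * ‖CFC.sqrt S_C‖ := mul_pos (norm_sqrt_pos hT) (norm_sqrt_pos hC)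
  let badF : Set Ω := {ω | δ ≤ ‖(T : ℝ)⁻¹ • ((F ω)ᵀ * F ω) - 1‖}
  let badE : Set Ω :=
    {ω | noiseConst b * √(max N T : ℝ) * (‖CFC.sqrt S_T‖ * ‖CFC.sqrt S_C‖) < ‖E ω‖}
  let badYE : Set Ω :=
    {ω | noiseConst b * √(T : ℝ) * (‖CFC.sqrt S_T‖ * ‖CFC.sqrt S_C‖) < ‖Yᵀ * E ω‖}
  let singular : Set Ω := {ω | ¬HasOneSidedInverse (dataMatrix L (F ω) (E ω))}
  have hbadE : μ.real badE ≤ Real.exp (-(b * (max N T : ℝ))) := by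
    simpa only [Matrix.transpose_one, Matrix.one_mul] using
      hE.measureReal_norm_transpose_mul_gt_le_exp hC.posSemidef hT.posSemidef hκ l2_opNorm_one_le hb
        (by rw [Fintype.card_fin, two_mul]; exact add_le_add (le_max_left _ _) (le_max_right _ _))
  have hbadYE : μ.real badYE ≤ Real.exp (-(b * T)) :=
    hE.measureReal_norm_transpose_mul_gt_le_exp hC.posSemidef hT.posSemidef hκ
      (l2_opNorm_le_one_of_orthonormal hY) hb (by rw [Fintype.card_fin, two_mul]; gcongr)
  have hsing : μ.real singular = 0 := (measureReal_eq_zero_iff (measure_ne_top μ _)).2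
    (ae_iff.1 (hE.ae_exists_inverse_dataMatrix hC hT L hF hind))
  obtain ⟨good, hgood, hprob, hdisj⟩ :=
    exists_measurableSet_disjoint μ (badF ∪ badE ∪ badYE ∪ singular)
  refine ⟨good, hgood, ?_, fun ω hω => ?_⟩
  · rw [← hprob]
    grw [measureReal_union_le, measureReal_union_le, measureReal_union_le, hconc, hbadE, hbadYE,
      hsing]
    linarith
  · simpa only [Set.mem_union, not_or, badF, badE, badYE, singular, Set.mem_ofPred_eq, not_le,
      not_lt, not_and_or, not_not, and_assoc] using Set.disjoint_left.1 hdisj hω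

end Event

end WPCA

theorem theorem2p3_general (A a : ℝ) (k : ℤ) (hA : 0 ≤ A) (ha : 0 ≤ a) (hk : 0 ≤ k) :
    ∃ C₀ C₁ : ℝ, 0 < C₀ ∧ 0 < C₁ ∧
      ∀ (Ω : Type*) [MeasurableSpace Ω] (μ : Measure Ω) [IsProbabilityMeasure μ]
        (N T r : ℕ) (hr : 0 < r)
        (L : Matrix (Fin N) (Fin r) ℝ) (lam : Fin r → ℝ)
        (F : Ω → Matrix (Fin T) (Fin r) ℝ) (E : Ω → Matrix (Fin N) (Fin T) ℝ)
        (S_C : Matrix (Fin N) (Fin N) ℝ) (S_T : Matrix (Fin T) (Fin T) ℝ)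
        (Q : Matrix (Fin T) (Fin T) ℝ) (η : ℝ),
        (∀ t j, AEMeasurable (fun ω => F ω t j) μ) →
        IndepFun (fun ω (p : Fin T × Fin r) => F ω p.1 p.2)
          (fun ω (p : Fin N × Fin T) => E ω p.1 p.2) μ →
        μ.real {ω | 1 / 2 ≤ ‖(T : ℝ)⁻¹ • ((F ω)ᵀ * F ω) - 1‖} ≤ η →
        (Lᵀ * L = Matrix.diagonal fun j => lam j ^ 2) → Antitone lam → (∀ j, 0 < lam j) →
        S_C.PosDef → S_T.PosDef →
        WPCA.SeparableGaussian μ E S_C S_T →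
        r ≤ Q.rank →
        Real.log (max N T : ℝ) ≤ A * T →
        ∃ good : Set Ω, MeasurableSet good ∧
          1 - η - (Real.exp (-a * N) + (max N T : ℝ) ^ (-k)) ≤ μ.real good ∧
          ∀ ω ∈ good,
            ∀ (U : Matrix (Fin N) (Fin r) ℝ) (s : Fin r → ℝ) (V : Matrix (Fin T) (Fin r) ℝ)
              (Uhat : Matrix (Fin N) (Fin r) ℝ) (shat : Fin r → ℝ)
              (Vhat : Matrix (Fin T) (Fin r) ℝ),
              WPCA.IsTruncSVD ((√(T : ℝ))⁻¹ • (L * (F ω)ᵀ)) U s V →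
              WPCA.IsWeightedPCA (WPCA.dataMatrix L (F ω) (E ω)) Q Uhat shat Vhat →
              C₀ * WPCA.errV (lam ⟨0, hr⟩) S_C S_T ‖Uhat * Uhatᵀ - U * Uᵀ‖
                  ≤ lam ⟨r - 1, Nat.sub_lt hr one_pos⟩ * √(T : ℝ) →
              ‖Vhat * Vhatᵀ - V * Vᵀ‖
                ≤ C₁ * (WPCA.errV (lam ⟨0, hr⟩) S_C S_T ‖Uhat * Uhatᵀ - U * Uᵀ‖
                  / (lam ⟨r - 1, Nat.sub_lt hr one_pos⟩ * √(T : ℝ))) := by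
  have hb : 0 ≤ a + k * A := by positivity
  have hK := WPCA.noiseConst_nonneg (a + k * A)
  refine ⟨4 * (2 + WPCA.noiseConst (a + k * A)), 6 * (2 + WPCA.noiseConst (a + k * A)),
    by positivity, by positivity, ?_⟩
  intro Ω _ μ _ N T r hr L lam F E S_C S_T Q η hF hind hconc hL hanti hpos hC hT hE hQ hlog
  obtain ⟨Y, hY, hLY⟩ := WPCA.exists_orthonormal_mul_diagonal hL hpos
  have hrT : r ≤ T := hQ.trans (Matrix.rank_le_height Q)
  have hT0 : 0 < T := hr.trans_le hrT
  have hN0 : 0 < N := hr.trans_le (WPCA.le_of_transpose_mul_self_eq_one hY)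
  obtain ⟨good, hgood, hprob, h⟩ :=
    WPCA.exists_good_event hE hC hT hN0 hT0 hrT hY L hF hind hconc hb
  refine ⟨good, hgood, le_trans ?_ hprob, fun ω hω U s V Uhat shat Vhat hsvd hhat herr => ?_⟩
  · have := WPCA.exp_neg_add_exp_neg_le hA ha hk hT0 hlog
    linarith
  · obtain ⟨hFω, hEω, hYEω, hX⟩ := h ω hω
    exact WPCA.norm_right_proj_sub_le_mul_errV hT0 hK hY hLY (hpos _).le (hpos _)
      (fun j => hanti (Nat.zero_le j)) (fun j => hanti (Nat.le_pred_of_lt j.2)) hFω.le hQ hEω hYEω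
      hX hsvd hhat herr

theorem theorem2p3 (A c : ℝ) (hA : 0 < A) (hc : 0 < c) :
    ∃ c₀ C₀ C₁ C₂ : ℝ, 0 < c₀ ∧ 0 < C₀ ∧ 0 < C₁ ∧ 0 < C₂ ∧
      ∀ (Ω : Type*) [MeasurableSpace Ω] (μ : Measure Ω) [IsProbabilityMeasure μ]
        (N T r : ℕ) (hr : 0 < r)
        (L : Matrix (Fin N) (Fin r) ℝ) (lam : Fin r → ℝ)
        (F : Ω → Matrix (Fin T) (Fin r) ℝ) (E : Ω → Matrix (Fin N) (Fin T) ℝ)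
        (S_C : Matrix (Fin N) (Fin N) ℝ) (S_T : Matrix (Fin T) (Fin T) ℝ)
        (Q : Matrix (Fin T) (Fin T) ℝ) (δ η : ℝ),
        δ ≤ 1 / 2 →
        WPCA.FactorAssumption μ L lam F E δ η →
        S_C.PosDef → S_T.PosDef →
        WPCA.SeparableGaussian μ E S_C S_T →
        Q.IsSymm → r ≤ Q.rank →
        (T : ℝ) ≤ A * Real.exp (c * N) →
        Real.log (max N T : ℝ) ≤ A * T →
        ∃ good : Set Ω, MeasurableSet good ∧
          1 - η - C₂ * (Real.exp (-c₀ * N) + (max N T : ℝ) ^ (-9 : ℤ)) ≤ μ.real good ∧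
          ∀ ω ∈ good,
            ∀ (U : Matrix (Fin N) (Fin r) ℝ) (s : Fin r → ℝ) (V : Matrix (Fin T) (Fin r) ℝ)
              (Uhat : Matrix (Fin N) (Fin r) ℝ) (shat : Fin r → ℝ)
              (Vhat : Matrix (Fin T) (Fin r) ℝ),
              WPCA.IsTruncSVD ((√(T : ℝ))⁻¹ • (L * (F ω)ᵀ)) U s V →
              WPCA.IsWeightedPCA (WPCA.dataMatrix L (F ω) (E ω)) Q Uhat shat Vhat →
              C₀ * WPCA.errV (lam ⟨0, hr⟩) S_C S_T ‖Uhat * Uhatᵀ - U * Uᵀ‖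
                  ≤ lam ⟨r - 1, Nat.sub_lt hr one_pos⟩ * √(T : ℝ) →
              ‖Vhat * Vhatᵀ - V * Vᵀ‖
                ≤ C₁ * (WPCA.errV (lam ⟨0, hr⟩) S_C S_T ‖Uhat * Uhatᵀ - U * Uᵀ‖
                  / (lam ⟨r - 1, Nat.sub_lt hr one_pos⟩ * √(T : ℝ))) := by
  obtain ⟨C₀, C₁, hC₀, hC₁, h⟩ := theorem2p3_general A 1 9 hA.le zero_le_one (by norm_num)
  refine ⟨1, C₀, C₁, 1, one_pos, hC₀, hC₁, one_pos, ?_⟩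
  intro Ω _ μ _ N T r hr L lam F E S_C S_T Q δ η hδ hfac hC hT hE _ hQ _ hlog
  have hconc : μ.real {ω | 1 / 2 ≤ ‖(T : ℝ)⁻¹ • ((F ω)ᵀ * F ω) - 1‖} ≤ η :=
    (measureReal_mono fun ω hω => hδ.trans hω).trans hfac.concentration
  simpa only [one_mul] using h Ω μ N T r hr L lam F E S_C S_T Q η
    (fun t j => (hfac.measurable_factor t j).aemeasurable) hfac.indep hconc hfac.loading
    hfac.lam_antitone hfac.lam_pos hC hT hE hQ hlog
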